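/- **Setting.** One item is sold to $n$ players with independent values $v_i\sim\mathcal D_i$, where each $\mathcal D_i$ is an arbitrary (possibly unbounded, possibly non-continuous) probability distribution on $[0,\infty)$; $\mathcal I$ denotes the instance and $\mathcal D=\times_i\mathcal D_i$. $OPT(\mathcal I)$ is the supremum of the expected revenues of the Bayesian incentive compatible (BIC), interim individually rational mechanisms. The quantile of a value is $q_i(z)=\Pr_{x\sim\mathcal D_i}[x\ge z]$, and a quantile query $q\in(0,1]$ to $\mathcal D_i$ is answered by $v_i(q)=\max\{z:\Pr_{x\sim\mathcal D_i}[x\ge z]\ge q\}$. **Small-Tail Assumption 2** (with tail function $h:(0,1)\to(0,1)$): there is an optimal BIC mechanism (of finite revenue $OPT(\mathcal I)$, with nonnegative payments) whose revenue $Rev_{OPT}(v;\mathcal I)$ at the value profile $v$ satisfies, for every $\delta_1\in(0,1)$, $$\mathbb E_{v\sim\mathcal D}\big[\mathbf 1_{\exists i:\ q_i(v_i)\le h(\delta_1)}\,Rev_{OPT}(v;\mathcal I)\big]\le\delta_1\,OPT(\mathcal I).$$ **Mechanism $\mathcal M_{EQM}$.** Given $\epsilon>0$, let $\delta=\epsilon/3$,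 $\epsilon_1=h\big(\tfrac{2\epsilon}{3(1+\epsilon)}\big)$, $k=\lceil\log_{1+\delta}(1/\epsilon_1)\rceil$, $q_0=1$, $q_l=\epsilon_1(1+\delta)^{k-l}$ for $1\le l\le k$, and $q_{k+1}=0$. For every player $i$, query $\mathcal D_i$ non-adaptively with the quantiles $q_0,\dots,q_k$, and let $\mathcal D_i'$ be the discrete distribution with mass $q_l-q_{l+1}$ at the answer $v_i(q_l)$, $0\le l\le k$. Then run Myerson's mechanism for the prior $\times_i\mathcal D_i'$ on the reported values: the player with the highest nonnegative ironed virtual value wins (values are rounded down to the support of $\mathcal D_i'$, values below the support never win, ties go to the smallest index) and pays the threshold price. **Theorem.** For every $\epsilon>0$ and every single-item instance $\mathcal I$ satisfying Small-Tail Assumption 2 with tail function $h$: 1. $\mathcal M_{EQM}$ is a feasible, individually rational and dominant-strategy incentive compatible (DSIC) mechanism; 2. it makes exactly $n\big(\lceil-\log_{1+\epsilon/3}h(\tfrac{2\epsilon}{3(1+\epsilon)})\rceil+1\big)$ queries, all of them quantile queries in $(0,1]$; this is $O\big(-n\log_{1+\epsilon/3}h(\tfrac{2\epsilon}{3(1+\epsilon)})\big)$,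 and precisely at most $-3n\log_{1+\epsilon/3}h(\tfrac{2\epsilon}{3(1+\epsilon)})$ whenever $-\log_{1+\epsilon/3}h(\tfrac{2\epsilon}{3(1+\epsilon)})\ge1$; 3. its expected revenue when the values are drawn from $\mathcal D$ is well defined and satisfies $$Rev(\mathcal M_{EQM}(\mathcal I))\ \ge\ \frac{OPT(\mathcal I)}{1+\epsilon}.$$ -/

import Mathlib

open MeasureTheory

namespace SingleItem

noncomputable section

/-! ### Single-item mechanisms -/

/-- A direct-revelation mechanism for one item and `n` players: `alloc b i` is the probability that
player `i` gets the item, and `pay b i` is the (expected) price charged to player `i`, when the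
reported values are `b`. -/
structure Mechanism (n : ℕ) where
  alloc : (Fin n → ℝ) → Fin n → ℝ
  pay : (Fin n → ℝ) → Fin n → ℝ

variable {n : ℕ}

/-- At most one item is sold, whatever the reports. -/
def Mechanism.Feasible (M : Mechanism n) : Prop :=
  ∀ b : Fin n → ℝ, (∀ i, 0 ≤ M.alloc b i) ∧ ∑ i, M.alloc b i ≤ 1

/-- Dominant-strategy incentive compatibility: whatever the others report, reporting the true value
`v ≥ 0` is at least as good as any report. Here `b i` is the deviating report of player `i`. -/
def Mechanism.DSIC (M : Mechanism n) : Prop :=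
  ∀ (i : Fin n) (b : Fin n → ℝ) (v : ℝ), 0 ≤ v →
    v * M.alloc b i - M.pay b i ≤
      v * M.alloc (Function.update b i v) i - M.pay (Function.update b i v) i

/-- Ex-post individual rationality of truthful reporting. -/
def Mechanism.ExPostIR (M : Mechanism n) : Prop :=
  ∀ (i : Fin n) (b : Fin n → ℝ), 0 ≤ b i → 0 ≤ b i * M.alloc b i - M.pay b i

/-- The revenue of the mechanism at the value profile `v`. -/
def Mechanism.revAt (M : Mechanism n) (v : Fin n → ℝ) : ℝ := ∑ i, M.pay v i

/-- The expected revenue of the mechanism when the values are drawn independently from `D`. -/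
def Mechanism.rev (M : Mechanism n) (D : Fin n → Measure ℝ) : ℝ :=
  ∫ v, M.revAt v ∂(Measure.pi D)

/-- Probability that player `i` wins when reporting `z`, over the values of the others. (The `i`-th
coordinate of the random profile is overwritten by `z`.) -/
def Mechanism.interimAlloc (M : Mechanism n) (D : Fin n → Measure ℝ) (i : Fin n) (z : ℝ) : ℝ :=
  ∫ b, M.alloc (Function.update b i z) i ∂(Measure.pi D)

/-- Expected price of player `i` when reporting `z`, over the values of the others. -/
def Mechanism.interimPay (M : Mechanism n) (D : Fin n → Measure ℝ) (i : Fin n) (z : ℝ) : ℝ :=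
  ∫ b, M.pay (Function.update b i z) i ∂(Measure.pi D)

/-- Bayesian incentive compatible mechanisms for the prior `D`: feasible, with well-defined expected
payments, Bayesian incentive compatible and interim individually rational. Payments may be
negative. -/
structure Mechanism.BIC (M : Mechanism n) (D : Fin n → Measure ℝ) : Prop where
  feasible : M.Feasible
  measurable_alloc : ∀ i, Measurable fun b => M.alloc b i
  measurable_pay : ∀ i, Measurable fun b => M.pay b i
  integrable_pay : ∀ i, Integrable (fun b => M.pay b i) (Measure.pi D)
  integrable_interim : ∀ (i : Fin n) (z : ℝ), 0 ≤ z →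
    Integrable (fun b => M.pay (Function.update b i z) i) (Measure.pi D)
  incentive : ∀ (i : Fin n) (v z : ℝ), 0 ≤ v → 0 ≤ z →
    v * M.interimAlloc D i z - M.interimPay D i z ≤
      v * M.interimAlloc D i v - M.interimPay D i v
  rational : ∀ (i : Fin n) (v : ℝ), 0 ≤ v →
    0 ≤ v * M.interimAlloc D i v - M.interimPay D i v

/-- `OPT`: the supremum of the revenues of the BIC mechanisms. -/
def OPT (D : Fin n → Measure ℝ) : ℝ :=
  sSup {r | ∃ M : Mechanism n, M.BIC D ∧ r = M.rev D}

/-- `M` is an optimal BIC mechanism (in particular the optimal revenue is finite, and attained). -/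
def Mechanism.IsOptimalBIC (M : Mechanism n) (D : Fin n → Measure ℝ) : Prop :=
  M.BIC D ∧ ∀ M' : Mechanism n, M'.BIC D → M'.rev D ≤ M.rev D

/-! ### Quantiles and the small-tail assumption -/

/-- The quantile of the value `z`: the probability `Pr[x ≥ z]`. -/
def quantile (F : Measure ℝ) (z : ℝ) : ℝ := (F (Set.Ici z)).toReal

/-- The oracle's answer to the quantile query `q`: the largest `z` with `Pr[x ≥ z] ≥ q` (a maximum
for every probability distribution when `0 < q ≤ 1`). -/
def quantileQuery (F : Measure ℝ) (q : ℝ) : ℝ := sSup {z | q ≤ quantile F z}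

/-- Small-Tail Assumption 2 with tail function `h`: the revenue that an optimal BIC mechanism (one
that never pays the players) makes on the event that some player's quantile is at most `h δ₁` is at
most `δ₁ * OPT`. -/
def SmallTail2 (D : Fin n → Measure ℝ) (h : ℝ → ℝ) : Prop :=
  (∀ δ₁ ∈ Set.Ioo (0 : ℝ) 1, h δ₁ ∈ Set.Ioo (0 : ℝ) 1) ∧
  ∃ M : Mechanism n, M.IsOptimalBIC D ∧
    (∀ v : Fin n → ℝ, (∀ j, 0 ≤ v j) → ∀ i, 0 ≤ M.pay v i) ∧
    ∀ δ₁ ∈ Set.Ioo (0 : ℝ) 1,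
      ∫ v, Set.indicator {v : Fin n → ℝ | ∃ i, quantile (D i) (v i) ≤ h δ₁} M.revAt v
        ∂(Measure.pi D) ≤ δ₁ * OPT D

/-! ### Myerson's mechanism -/

/-- The revenue curve in quantile space: `q` times the price that sells with probability `q`. -/
def revCurve (F : Measure ℝ) (q : ℝ) : ℝ := q * quantileQuery F q

/-- The ironed revenue curve: the least concave majorant of the revenue curve on `[0, 1]`. -/
def ironedCurve (F : Measure ℝ) (q : ℝ) : ℝ :=
  sInf {y | ∃ g : ℝ → ℝ, ConcaveOn ℝ (Set.Icc 0 1) g ∧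
    (∀ t ∈ Set.Icc (0 : ℝ) 1, revCurve F t ≤ g t) ∧ y = g q}

/-- The ironed virtual value of `z`: the right derivative of the ironed revenue curve at the quantile
`Pr[x > z]`, which by concavity is the supremum of the slopes of the chords to the right of that
point. It is constant between consecutive points of the support of a discrete `F` (values are
rounded down to the support), and `-∞` for `z` below the support. -/
def ironedVirtualValue (F : Measure ℝ) (z : ℝ) : EReal :=
  ⨆ q ∈ Set.Ioc (F (Set.Ioi z)).toReal 1,
    (((ironedCurve F q - ironedCurve F (F (Set.Ioi z)).toReal) /
      (q - (F (Set.Ioi z)).toReal) : ℝ) : EReal)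

/-- Player `i` has the highest ironed virtual value, and it is nonnegative; ties are broken in favour
of the smallest index. -/
def MyersonWins (F : Fin n → Measure ℝ) (b : Fin n → ℝ) (i : Fin n) : Prop :=
  0 ≤ ironedVirtualValue (F i) (b i) ∧
  (∀ j, ironedVirtualValue (F j) (b j) ≤ ironedVirtualValue (F i) (b i)) ∧
  ∀ j < i, ironedVirtualValue (F j) (b j) < ironedVirtualValue (F i) (b i)

open Classical in
/-- Myerson's mechanism for the prior `F`: the winner pays the threshold, i.e. the infimum of the
reports with which that player would still win. -/
def myerson (F : Fin n → Measure ℝ) : Mechanism n where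
  alloc b i := if MyersonWins F b i then 1 else 0
  pay b i :=
    if MyersonWins F b i then sInf {z : ℝ | 0 ≤ z ∧ MyersonWins F (Function.update b i z) i} else 0

/-! ### Mechanisms that access the prior through quantile queries -/

/-- A mechanism that makes non-adaptive quantile queries: it fixes all its queries about all the
players' distributions in advance, and the auction it runs depends on the answers only. -/
structure QueryMechanism (n : ℕ) where
  numQueries : Fin n → ℕ
  query : (i : Fin n) → Fin (numQueries i) → ℝ
  run : ((i : Fin n) → Fin (numQueries i) → ℝ) → Mechanism n

/-- The total number of queries. -/
def QueryMechanism.queryComplexity (Q : QueryMechanism n) : ℕ := ∑ i, Q.numQueries i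

/-- The auction that is run when the oracle answers according to the true distributions `D`. -/
def QueryMechanism.onPrior (Q : QueryMechanism n) (D : Fin n → Measure ℝ) : Mechanism n :=
  Q.run fun i l => quantileQuery (D i) (Q.query i l)

/-- The number `k = ⌈log_{1+δ} (1/ε₁)⌉`. -/
def levels (ε₁ δ : ℝ) : ℕ := ⌈Real.logb (1 + δ) (1 / ε₁)⌉₊

/-- The quantile vector `(q_0, …, q_k) = (1, ε₁(1+δ)^(k-1), …, ε₁(1+δ), ε₁)`, and `q_{k+1} = 0`. -/
def quantileVector (ε₁ δ : ℝ) (l : ℕ) : ℝ :=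
  if l = 0 then 1 else if l ≤ levels ε₁ δ then ε₁ * (1 + δ) ^ (levels ε₁ δ - l) else 0

/-- The discrete distribution returned by the quantile-query algorithm on the answers `v`: mass
`q_l - q_{l+1}` at `v_l`. -/
def learnedDist (ε₁ δ : ℝ) (v : Fin (levels ε₁ δ + 1) → ℝ) : Measure ℝ :=
  ∑ l : Fin (levels ε₁ δ + 1),
    ENNReal.ofReal (quantileVector ε₁ δ l - quantileVector ε₁ δ (l + 1)) • Measure.dirac (v l)

/-- The parameter `δ₁ = 2ε / (3(1+ε))`. -/
def tailParam (ε : ℝ) : ℝ := 2 * ε / (3 * (1 + ε))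

/-- The efficient quantile Myerson mechanism: learn a discrete distribution for every player with
precision `ε/3` and tail length `h(2ε/(3(1+ε)))`, then run Myerson's mechanism on what was learned. -/
def efficientQuantileMyerson (n : ℕ) (h : ℝ → ℝ) (ε : ℝ) : QueryMechanism n where
  numQueries _ := levels (h (tailParam ε)) (ε / 3) + 1
  query _ l := quantileVector (h (tailParam ε)) (ε / 3) l
  run answers := myerson fun i => learnedDist (h (tailParam ε)) (ε / 3) (answers i)

end

end SingleItem

namespace SingleItem

noncomputable section

open Filter Topology Set

variable {n : ℕ}

/-! ### Quantile functions -/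

/-! Write `a l` for the answer to the query `q l`, and `R` for the ironed revenue curve of the
learned distribution. In quantile space each player has a learned virtual value `ψ`: on the cell `(q
(l+1), q l]` it is the slope of `R` over that cell (`cellSlope`, `learnedSlope`). The revenue bound
compares two quantities with the expected learned virtual welfare `E ∑ ψ⁺ x` of one allocation `x`.

Lower bound on the mechanism (`le_myerson_rev`, `integral_learnedSlope_le_rev`): Myerson's mechanism
for the learned prior, run on the true prior, earns at least `E ∑ ψ⁺ x` for every feasible `x`. Fix
the other players and let `s` be the rival virtual value. The player faces a posted price whose sale
probability under `D` is at least the learned one, since `Pr[v ≥ a l] ≥ q l`. So its revenue is at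
least `s` per sale plus `E (ψ - s)⁺` (`pricing`). Pointwise these credits add up to at least the
highest `ψ⁺` (`le_sum_credit`). This avoids any comparison of the optimal revenues of two priors.

Upper bound on the optimum (`integral_pay_le`, `integral_nontail_revAt_le`): incentive compatibility
bounds a non-tail interim payment by grid prices `a (l+1)` times increments of the interim
allocation. The price `a (l+1)` is charged only when `v > a l`, which has probability at most `q l ≤
(1+δ) q (l+1)`. Summation by parts against `R (q l) ≥ q l * a l` then gives `(1+δ) E ∑ ψ⁺ x` for the
optimal allocation `x`.

The tail carries at most a fraction `δ₁` of `OPT`, so `(1-δ₁) OPT ≤ (1+δ) Rev`, and the parameters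
satisfy `1-δ₁ = (1+δ)/(1+ε)`. Truthfulness is the usual monotone-allocation, threshold-price
argument. -/

lemma quantile_antitone (F : Measure ℝ) [IsFiniteMeasure F] : Antitone (quantile F) := fun _ _ h =>
  ENNReal.toReal_mono (measure_ne_top _ _) (measure_mono (Ici_subset_Ici.2 h))

lemma quantile_eq_one (F : Measure ℝ) [IsProbabilityMeasure F] (hF : F (Iio 0) = 0)
    {z : ℝ} (hz : z ≤ 0) : quantile F z = 1 := by
  have h0 : F (Iio z) = 0 := measure_mono_null (Iio_subset_Iio hz) hF
  have h1 : F (Ici z) = 1 := by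
    rw [← compl_Iio, prob_compl_eq_one_iff measurableSet_Iio]
    exact h0
  simp [quantile, h1]

/-- Continuity from above. With `s = ∅` it bounds the set defining a query; with `s = Ici w` it is
left-continuity, which makes the supremum a maximum. -/
lemma tendsto_quantile_of_iInter (F : Measure ℝ) [IsFiniteMeasure F] {x : ℕ → ℝ} (hx : Monotone x)
    {s : Set ℝ} (hs : ⋂ n, Ici (x n) = s) :
    Tendsto (fun n => quantile F (x n)) atTop (𝓝 (F s).toReal) := by
  have h := tendsto_measure_iInter_atTop (μ := F) (s := fun n => Ici (x n))
    (fun n => measurableSet_Ici.nullMeasurableSet) (fun a b hab => Ici_subset_Ici.2 (hx hab))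
    ⟨0, measure_ne_top _ _⟩
  rw [hs] at h
  exact (ENNReal.tendsto_toReal (measure_ne_top _ _)).comp h

lemma bddAbove_quantile_ge (F : Measure ℝ) [IsFiniteMeasure F] {u : ℝ} (hu : 0 < u) :
    BddAbove {z | u ≤ quantile F z} := by
  have h := tendsto_quantile_of_iInter F (x := fun n : ℕ => (n : ℝ)) (s := ∅) Nat.mono_cast (by
    ext y
    simp only [mem_iInter, mem_Ici, mem_empty_iff_false, iff_false, not_forall, not_le]
    exact exists_nat_gt y)
  simp only [measure_empty, ENNReal.toReal_zero] at h
  obtain ⟨n, hn⟩ := (h.eventually_lt_const hu).exists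
  refine ⟨n, fun z hz => ?_⟩
  by_contra! hlt
  exact absurd (lt_of_le_of_lt (hz.trans (quantile_antitone F hlt.le)) hn) (lt_irrefl _)

lemma le_quantile_quantileQuery (F : Measure ℝ) [IsFiniteMeasure F] {u : ℝ}
    (hne : {z | u ≤ quantile F z}.Nonempty) : u ≤ quantile F (quantileQuery F u) := by
  set w := quantileQuery F u with hw
  have hlt : ∀ z < w, u ≤ quantile F z := fun z hz => by
    obtain ⟨y, hy, hzy⟩ := exists_lt_of_lt_csSup hne hz
    exact le_trans hy (quantile_antitone F hzy.le)
  obtain ⟨x, hx, hxw, hxt⟩ := exists_seq_strictMono_tendsto w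
  have h := tendsto_quantile_of_iInter F (s := Ici w) hx.monotone (by
    ext y
    simp only [mem_iInter, mem_Ici]
    exact ⟨fun h => le_of_tendsto' hxt h, fun h n => (hxw n).le.trans h⟩)
  exact ge_of_tendsto' h fun n => hlt _ (hxw n)

/-- The oracle's answer is the upper adjoint of the quantile. -/
lemma le_quantileQuery_iff (F : Measure ℝ) [IsProbabilityMeasure F] (hF : F (Iio 0) = 0)
    {u : ℝ} (hu : u ∈ Ioc (0 : ℝ) 1) {z : ℝ} : z ≤ quantileQuery F u ↔ u ≤ quantile F z := by
  have hne : {z | u ≤ quantile F z}.Nonempty :=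
    ⟨0, by simpa [quantile_eq_one F hF le_rfl] using hu.2⟩
  exact ⟨fun h => (le_quantile_quantileQuery F hne).trans (quantile_antitone F h),
    fun h => le_csSup (bddAbove_quantile_ge F hu.1) h⟩

/-- The defining set is all of `ℝ` or empty, and both suprema have the default value 0. Statements
over all real `u` therefore need no restriction to `(0, 1]`. -/
lemma quantileQuery_of_notMem (F : Measure ℝ) [IsProbabilityMeasure F] {u : ℝ}
    (hu : u ∉ Ioc (0 : ℝ) 1) : quantileQuery F u = 0 := by
  by_cases h0 : u ≤ 0
  · have : {z | u ≤ quantile F z} = univ := by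
      ext z
      simp only [mem_ofPred_eq, mem_univ, iff_true]
      exact h0.trans measureReal_nonneg
    simp [quantileQuery, this]
  · have : {z | u ≤ quantile F z} = ∅ := by
      ext z
      simp only [mem_ofPred_eq, mem_empty_iff_false, iff_false, not_le]
      have h1 : 1 < u := by
        by_contra! h
        exact hu ⟨not_le.1 h0, h⟩
      exact lt_of_le_of_lt measureReal_le_one h1
    simp [quantileQuery, this]

lemma quantileQuery_nonneg (F : Measure ℝ) [IsProbabilityMeasure F] (hF : F (Iio 0) = 0) (u : ℝ) :
    0 ≤ quantileQuery F u := by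
  by_cases hu : u ∈ Ioc (0 : ℝ) 1
  · rw [le_quantileQuery_iff F hF hu, quantile_eq_one F hF le_rfl]
    exact hu.2
  · exact (quantileQuery_of_notMem F hu).ge

lemma quantileQuery_antitoneOn (F : Measure ℝ) [IsProbabilityMeasure F] (hF : F (Iio 0) = 0) :
    AntitoneOn (quantileQuery F) (Ioc 0 1) := fun _ hu _ hv huv =>
  (le_quantileQuery_iff F hF hu).2 (huv.trans ((le_quantileQuery_iff F hF hv).1 le_rfl))

/-- The uniform distribution on `(0, 1]`. -/
def unifDist : Measure ℝ := volume.restrict (Ioc 0 1)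

instance : IsProbabilityMeasure unifDist := ⟨by simp [unifDist]⟩

lemma preimage_quantileQuery (F : Measure ℝ) [IsProbabilityMeasure F] (hF : F (Iio 0) = 0) (z : ℝ) :
    quantileQuery F ⁻¹' Ici z = if z ≤ 0 then univ else Ioc 0 (quantile F z) := by
  split_ifs with hz
  · ext u
    simpa using hz.trans (quantileQuery_nonneg F hF u)
  · ext u
    simp only [mem_preimage, mem_Ici, mem_Ioc]
    by_cases hu : u ∈ Ioc (0 : ℝ) 1
    · rw [le_quantileQuery_iff F hF hu]
      exact ⟨fun h => ⟨hu.1, h⟩, fun h => h.2⟩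
    · rw [quantileQuery_of_notMem F hu]
      refine ⟨fun h => absurd h hz, fun h => absurd ⟨h.1, h.2.trans measureReal_le_one⟩ hu⟩

/-- A uniformly random quantile yields a value with distribution `F`. -/
lemma measurePreserving_quantileQuery (F : Measure ℝ) [IsProbabilityMeasure F]
    (hF : F (Iio 0) = 0) : MeasurePreserving (quantileQuery F) unifDist F := by
  have hm : Measurable (quantileQuery F) := measurable_of_Ici fun z => by
    rw [preimage_quantileQuery F hF]
    split_ifs <;> measurability
  refine ⟨hm, ?_⟩
  have := Measure.isProbabilityMeasure_map (μ := unifDist) hm.aemeasurable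
  refine Measure.ext_of_Ici _ _ fun z => ?_
  rw [Measure.map_apply hm measurableSet_Ici, preimage_quantileQuery F hF]
  split_ifs with hz
  · have h := quantile_eq_one F hF hz
    rw [quantile, ENNReal.toReal_eq_one_iff] at h
    simp [h]
  · have h1 : quantile F z ≤ 1 := measureReal_le_one
    rw [unifDist, Measure.restrict_apply measurableSet_Ioc, Ioc_inter_Ioc]
    rw [min_eq_left h1]
    simp [quantile]

/-- Values strictly above the answer to `u` come only from quantiles at most `u`. The strict
inequality matters: with an atom at the answer, the closed tail can exceed `u`. -/
lemma measure_Ioi_quantileQuery_le (F : Measure ℝ) [IsProbabilityMeasure F] (hF : F (Iio 0) = 0)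
    {u : ℝ} (hu : u ∈ Ioc (0 : ℝ) 1) : F.real (Ioi (quantileQuery F u)) ≤ u := by
  have hpre : quantileQuery F ⁻¹' Ioi (quantileQuery F u) ∩ Ioc 0 1 ⊆ Ioc 0 u := by
    rintro t ⟨ht, ht1⟩
    refine ⟨ht1.1, ?_⟩
    by_contra! h
    exact absurd (quantileQuery_antitoneOn F hF hu ht1 h.le) (not_le.2 ht)
  have hmp := measurePreserving_quantileQuery F hF
  have : F (Ioi (quantileQuery F u)) ≤ ENNReal.ofReal u := by
    rw [← hmp.measure_preimage measurableSet_Ioi.nullMeasurableSet, unifDist,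
      Measure.restrict_apply (hmp.measurable measurableSet_Ioi)]
    exact (measure_mono hpre).trans (by simp)
  exact ENNReal.toReal_le_of_le_ofReal hu.1.le this

/-! ### Resampling one coordinate -/

/-- Overwriting one coordinate with a fresh independent draw preserves the product law. Interim
quantities are defined by such overwriting, so this is the form of Fubini needed throughout. -/
lemma measurePreserving_update (D : Fin n → Measure ℝ) [∀ i, IsProbabilityMeasure (D i)]
    (i : Fin n) :
    MeasurePreserving (fun p : (Fin n → ℝ) × ℝ => Function.update p.1 i p.2)
      ((Measure.pi D).prod (D i)) (Measure.pi D) := by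
  have hm : Measurable (fun p : (Fin n → ℝ) × ℝ => Function.update p.1 i p.2) := by
    refine measurable_pi_lambda _ fun j => ?_
    by_cases hj : j = i
    · subst hj
      simpa using measurable_snd
    · simp only [Function.update_of_ne hj]
      fun_prop
  refine ⟨hm, (Measure.pi_eq fun s hs => ?_).symm⟩
  rw [Measure.map_apply hm (MeasurableSet.univ_pi hs)]
  have : (fun p : (Fin n → ℝ) × ℝ => Function.update p.1 i p.2) ⁻¹' univ.pi s
      = univ.pi (Function.update s i univ) ×ˢ s i := by
    ext ⟨b, z⟩
    simp only [mem_preimage, mem_univ_pi, mem_prod]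
    constructor
    · intro h
      refine ⟨fun j => ?_, by simpa using h i⟩
      by_cases hj : j = i
      · subst hj; simp
      · simpa [Function.update_of_ne hj] using h j
    · rintro ⟨h1, h2⟩ j
      by_cases hj : j = i
      · subst hj; simpa using h2
      · simpa [Function.update_of_ne hj] using h1 j
  rw [this, Measure.prod_prod, Measure.pi_pi, ← Finset.prod_erase_mul _ _ (Finset.mem_univ i),
    ← Finset.prod_erase_mul _ (fun j => D j (s j)) (Finset.mem_univ i)]
  simp only [Function.update_self, measure_univ, mul_one]
  congr 1
  exact Finset.prod_congr rfl fun j hj => by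
    rw [Function.update_of_ne (Finset.ne_of_mem_erase hj)]

section resample
variable {D : Fin n → Measure ℝ} [∀ i, IsProbabilityMeasure (D i)] {f : (Fin n → ℝ) → ℝ}

lemma integrable_update (i : Fin n) (hf : Integrable f (Measure.pi D)) :
    Integrable (fun p : (Fin n → ℝ) × ℝ => f (Function.update p.1 i p.2))
      ((Measure.pi D).prod (D i)) :=
  (measurePreserving_update D i).integrable_comp_of_integrable hf

lemma integral_update (i : Fin n) (hf : Integrable f (Measure.pi D)) :
    ∫ b, f b ∂(Measure.pi D) =
      ∫ p : (Fin n → ℝ) × ℝ, f (Function.update p.1 i p.2) ∂((Measure.pi D).prod (D i)) := by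
  have h := measurePreserving_update D i
  conv_lhs => rw [← h.map_eq]
  rw [integral_map h.measurable.aemeasurable]
  rw [h.map_eq]
  exact hf.aestronglyMeasurable

lemma integral_eq_integral_integral_update (i : Fin n) (hf : Integrable f (Measure.pi D)) :
    ∫ b, f b ∂(Measure.pi D) =
      ∫ b, ∫ z, f (Function.update b i z) ∂(D i) ∂(Measure.pi D) := by
  rw [integral_update i hf, integral_prod _ (integrable_update i hf)]

lemma integral_eq_integral_integral_update_symm (i : Fin n) (hf : Integrable f (Measure.pi D)) :
    ∫ b, f b ∂(Measure.pi D) =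
      ∫ z, ∫ b, f (Function.update b i z) ∂(Measure.pi D) ∂(D i) := by
  rw [integral_update i hf, integral_prod_symm _ (integrable_update i hf)]

end resample

/-! ### Discrete distributions on a quantile grid -/

/-- Quantiles `1 = q 0 > q 1 > ... > q k > q (k + 1) = 0` with nonnegative values
`a 0 ≤ a 1 ≤ ... ≤ a k`. -/
structure IsGrid (k : ℕ) (q a : ℕ → ℝ) : Prop where
  q_zero : q 0 = 1
  q_last : q (k + 1) = 0
  q_lt : ∀ l ≤ k, q (l + 1) < q l
  a_zero : 0 ≤ a 0
  a_le : ∀ l < k, a l ≤ a (l + 1)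

/-- The distribution with mass `q l - q (l + 1)` at `a l` for `l ≤ k`. -/
def gridDist (k : ℕ) (q a : ℕ → ℝ) : Measure ℝ :=
  ∑ l : Fin (k + 1), ENNReal.ofReal (q l - q (l + 1)) • Measure.dirac (a l)

namespace IsGrid

variable {k : ℕ} {q a : ℕ → ℝ}

lemma q_anti (G : IsGrid k q a) {i j : ℕ} (hij : i ≤ j) (hj : j ≤ k + 1) : q j ≤ q i := by
  induction j, hij using Nat.le_induction with
  | base => exact le_rfl
  | succ m hm ih => exact (G.q_lt m (by omega)).le.trans (ih (by omega))

lemma a_mono (G : IsGrid k q a) {i j : ℕ} (hij : i ≤ j) (hj : j ≤ k) : a i ≤ a j := by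
  induction j, hij using Nat.le_induction with
  | base => exact le_rfl
  | succ m hm ih => exact (ih (by omega)).trans (G.a_le m (by omega))

lemma a_nonneg (G : IsGrid k q a) {l : ℕ} (hl : l ≤ k) : 0 ≤ a l :=
  G.a_zero.trans (G.a_mono (Nat.zero_le l) hl)

lemma q_nonneg (G : IsGrid k q a) {l : ℕ} (hl : l ≤ k + 1) : 0 ≤ q l :=
  G.q_last.symm.le.trans (G.q_anti hl le_rfl)

lemma q_pos (G : IsGrid k q a) {l : ℕ} (hl : l ≤ k) : 0 < q l :=
  (G.q_nonneg (by omega)).trans_lt (G.q_lt l hl)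

lemma q_le_one (G : IsGrid k q a) {l : ℕ} (hl : l ≤ k + 1) : q l ≤ 1 :=
  (G.q_anti (Nat.zero_le l) hl).trans G.q_zero.le

lemma q_mem (G : IsGrid k q a) {l : ℕ} (hl : l ≤ k + 1) : q l ∈ Icc (0 : ℝ) 1 :=
  ⟨G.q_nonneg hl, G.q_le_one hl⟩

lemma exists_level (G : IsGrid k q a) {t : ℝ} (ht : t ∈ Ioc (0 : ℝ) 1) :
    ∃ l ≤ k, t ∈ Ioc (q (l + 1)) (q l) := by
  classical
  set P : ℕ → Prop := fun l => t ≤ q l with hP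
  have h0 : P 0 := by simpa [hP, G.q_zero] using ht.2
  have hle := Nat.findGreatest_le (P := P) k
  refine ⟨Nat.findGreatest P k, hle, ?_, Nat.findGreatest_spec (Nat.zero_le k) h0⟩
  rcases hle.lt_or_eq with h | h
  · exact not_le.1 (Nat.findGreatest_is_greatest (P := P) (Nat.lt_succ_self _) h)
  · rw [h, G.q_last]
    exact ht.1

lemma sum_mass (G : IsGrid k q a) {m : ℕ} (hm : m ≤ k + 1) :
    ∑ l ∈ Finset.Ico m (k + 1), (q l - q (l + 1)) = q m := by
  have h := Finset.sum_Ico_sub q hm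
  rw [← neg_inj, ← Finset.sum_neg_distrib]
  simp only [neg_sub]
  rw [h, G.q_last]
  ring

/-- Atoms of the true distribution can make several `a l` coincide, so masses are counted over
indices rather than points. For the same reason only the inequalities below, not exact values, tie
tails to `q`. -/
lemma gridDist_real (G : IsGrid k q a) {s : Set ℝ} (hs : MeasurableSet s) :
    (gridDist k q a).real s =
      ∑ l ∈ Finset.range (k + 1), s.indicator (fun _ => q l - q (l + 1)) (a l) := by
  rw [gridDist, Measure.real, Measure.finsetSum_apply, ENNReal.toReal_sum, Finset.sum_range]
  · refine Finset.sum_congr rfl fun l _ => ?_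
    have := (G.q_lt l (by omega)).le
    by_cases h : a l ∈ s
    · simp [Measure.dirac_apply' _ hs, h, this]
    · simp [Measure.dirac_apply' _ hs, h]
  · intro l _
    rw [Measure.smul_apply, Measure.dirac_apply' _ hs]
    exact ENNReal.mul_ne_top ENNReal.ofReal_ne_top (by
      by_cases h : a l ∈ s <;> simp [h])

lemma isProbabilityMeasure_gridDist (G : IsGrid k q a) : IsProbabilityMeasure (gridDist k q a) := by
  refine ⟨?_⟩
  have h := G.gridDist_real MeasurableSet.univ
  simp only [indicator_univ] at h
  rw [Finset.range_eq_Ico, G.sum_mass (Nat.zero_le _), G.q_zero, Measure.real,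
    ENNReal.toReal_eq_one_iff] at h
  exact h

lemma le_gridDist_real (G : IsGrid k q a) {s : Set ℝ} (hs : MeasurableSet s) {m : ℕ}
    (hm : m ≤ k + 1) (h : ∀ l, m ≤ l → l ≤ k → a l ∈ s) : q m ≤ (gridDist k q a).real s := by
  rw [G.gridDist_real hs, ← G.sum_mass hm]
  rw [Finset.sum_congr rfl (g := fun l => s.indicator (fun _ => q l - q (l + 1)) (a l))
    fun l hl => by
      rw [Finset.mem_Ico] at hl
      rw [indicator_of_mem (h l hl.1 (by omega))]]
  refine Finset.sum_le_sum_of_subset_of_nonneg (fun l hl => ?_) fun l hl _ => ?_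
  · simp only [Finset.mem_Ico, Finset.mem_range] at hl ⊢
    exact hl.2
  · refine indicator_nonneg (fun _ _ => ?_) _
    have := G.q_lt l (by simp only [Finset.mem_range] at hl; omega)
    linarith

lemma gridDist_real_le (G : IsGrid k q a) {s : Set ℝ} (hs : MeasurableSet s) {m : ℕ}
    (hm : m ≤ k + 1) (h : ∀ l < m, a l ∉ s) : (gridDist k q a).real s ≤ q m := by
  rw [G.gridDist_real hs, ← G.sum_mass hm, Finset.range_eq_Ico,
    ← Finset.sum_Ico_consecutive _ (Nat.zero_le m) hm,
    Finset.sum_eq_zero (s := Finset.Ico 0 m) fun l hl => by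
      rw [indicator_of_notMem (h l (Finset.mem_Ico.1 hl).2)], zero_add]
  refine Finset.sum_le_sum fun l hl => indicator_apply_le' (fun _ => le_rfl) fun _ => ?_
  have := G.q_lt l (by simp only [Finset.mem_Ico] at hl; omega)
  linarith

lemma real_Ioi_mem (G : IsGrid k q a) (z : ℝ) :
    (gridDist k q a).real (Ioi z) ∈ Icc (0 : ℝ) 1 := by
  have := G.isProbabilityMeasure_gridDist
  exact ⟨measureReal_nonneg, measureReal_le_one⟩

lemma le_real_Ioi (G : IsGrid k q a) {l : ℕ} (hl : l ≤ k) {z : ℝ} (h : z < a l) :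
    q l ≤ (gridDist k q a).real (Ioi z) :=
  G.le_gridDist_real measurableSet_Ioi (by omega) fun _ h1 h2 => h.trans_le (G.a_mono h1 h2)

lemma real_Ioi_le (G : IsGrid k q a) {l : ℕ} (hl : l ≤ k) {z : ℝ} (h : a l ≤ z) :
    (gridDist k q a).real (Ioi z) ≤ q (l + 1) :=
  G.gridDist_real_le measurableSet_Ioi (by omega) fun j hj =>
    not_lt.2 ((G.a_mono (by omega) hl).trans h)

lemma gridDist_Iio_zero (G : IsGrid k q a) : gridDist k q a (Iio 0) = 0 := by
  have := G.isProbabilityMeasure_gridDist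
  have h := G.gridDist_real_le (s := Iio 0) measurableSet_Iio le_rfl fun l hl =>
    not_lt.2 (G.a_nonneg (by omega))
  rw [G.q_last] at h
  rw [← measureReal_eq_zero_iff]
  exact le_antisymm h measureReal_nonneg

lemma quantileQuery_le (G : IsGrid k q a) {l : ℕ} (hl : l ≤ k) {t : ℝ} (ht : q (l + 1) < t) :
    quantileQuery (gridDist k q a) t ≤ a l := by
  refine Real.sSup_le (fun z hz => ?_) (G.a_nonneg hl)
  by_contra! h
  refine absurd (ht.trans_le (le_trans hz (G.gridDist_real_le measurableSet_Ici (by omega)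
    fun j hj => ?_))) (lt_irrefl _)
  exact not_le.2 ((G.a_mono (by omega) hl).trans_lt h)

lemma le_quantileQuery (G : IsGrid k q a) {l : ℕ} (hl : l ≤ k) :
    a l ≤ quantileQuery (gridDist k q a) (q l) := by
  have := G.isProbabilityMeasure_gridDist
  rw [le_quantileQuery_iff _ G.gridDist_Iio_zero ⟨G.q_pos hl, G.q_le_one (by omega)⟩]
  exact G.le_gridDist_real measurableSet_Ici (by omega) fun j h1 h2 => G.a_mono h1 h2

/-! ### The ironed revenue curve -/

/-- On a cell the revenue curve is at most `t * a l`. If `a l ≤ s`, a nonnegative intercept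
suffices; otherwise `(a l - s) * t` is largest at the right end `t = q l`, a grid point. -/
lemma revCurve_le_affine (G : IsGrid k q a) {c s : ℝ} (hc : 0 ≤ c)
    (h : ∀ l ≤ k, q l * a l ≤ c + s * q l) {t : ℝ} (ht : t ∈ Icc (0 : ℝ) 1) :
    revCurve (gridDist k q a) t ≤ c + s * t := by
  rcases ht.1.eq_or_lt with h0 | h0
  · rw [← h0]
    simpa [revCurve] using hc
  obtain ⟨l, hl, hlt⟩ := G.exists_level ⟨h0, ht.2⟩
  have h1 : revCurve (gridDist k q a) t ≤ t * a l :=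
    mul_le_mul_of_nonneg_left (G.quantileQuery_le hl hlt.1) h0.le
  refine h1.trans ?_
  rcases le_total (a l) s with h2 | h2
  · nlinarith
  · nlinarith [h l hl, mul_le_mul_of_nonneg_right hlt.2 (sub_nonneg.2 h2)]

lemma concaveOn_affine (c s : ℝ) : ConcaveOn ℝ (Icc (0 : ℝ) 1) fun t => c + s * t :=
  ⟨convex_Icc 0 1, fun x _ y _ α β _ _ hab => by
    simp only [smul_eq_mul]
    have : c = (α + β) * c := by rw [hab, one_mul]
    nth_rewrite 3 [this]
    exact le_of_eq (by ring)⟩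

lemma bddBelow_majorants (F : Measure ℝ) {t : ℝ} (ht : t ∈ Icc (0 : ℝ) 1) :
    BddBelow {y | ∃ g : ℝ → ℝ, ConcaveOn ℝ (Icc 0 1) g ∧
      (∀ t ∈ Icc (0 : ℝ) 1, revCurve F t ≤ g t) ∧ y = g t} :=
  ⟨revCurve F t, by rintro y ⟨g, -, hg, rfl⟩; exact hg t ht⟩

lemma ironedCurve_le (F : Measure ℝ) {g : ℝ → ℝ} (hg : ConcaveOn ℝ (Icc 0 1) g)
    (h : ∀ t ∈ Icc (0 : ℝ) 1, revCurve F t ≤ g t) {t : ℝ} (ht : t ∈ Icc (0 : ℝ) 1) :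
    ironedCurve F t ≤ g t :=
  csInf_le (bddBelow_majorants F ht) ⟨g, hg, h, rfl⟩

lemma ironedCurve_le_affine (G : IsGrid k q a) {c s : ℝ} (hc : 0 ≤ c)
    (h : ∀ l ≤ k, q l * a l ≤ c + s * q l) {t : ℝ} (ht : t ∈ Icc (0 : ℝ) 1) :
    ironedCurve (gridDist k q a) t ≤ c + s * t :=
  ironedCurve_le _ (concaveOn_affine c s) (fun _ => G.revCurve_le_affine hc h) ht

lemma ironedCurve_le_linear (G : IsGrid k q a) {t : ℝ} (ht : t ∈ Icc (0 : ℝ) 1) :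
    ironedCurve (gridDist k q a) t ≤ a k * t := by
  have h := G.ironedCurve_le_affine (c := 0) (s := a k) le_rfl (fun l hl => by
    nlinarith [G.a_mono hl le_rfl, G.q_pos hl]) ht
  linarith

lemma le_ironedCurve (G : IsGrid k q a) {t y : ℝ}
    (h : ∀ g : ℝ → ℝ, ConcaveOn ℝ (Icc 0 1) g →
      (∀ t ∈ Icc (0 : ℝ) 1, revCurve (gridDist k q a) t ≤ g t) → y ≤ g t) :
    y ≤ ironedCurve (gridDist k q a) t := by
  refine le_csInf ⟨_, fun t => 0 + a k * t, concaveOn_affine _ _,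
    fun t ht => G.revCurve_le_affine le_rfl (fun l hl => ?_) ht, rfl⟩ ?_
  · nlinarith [G.a_mono hl le_rfl, G.q_pos hl]
  · rintro y ⟨g, h1, h2, rfl⟩
    exact h g h1 h2

lemma revCurve_le_ironedCurve (G : IsGrid k q a) {t : ℝ} (ht : t ∈ Icc (0 : ℝ) 1) :
    revCurve (gridDist k q a) t ≤ ironedCurve (gridDist k q a) t :=
  G.le_ironedCurve fun _ _ h => h t ht

lemma le_ironedCurve_q (G : IsGrid k q a) {l : ℕ} (hl : l ≤ k) :
    q l * a l ≤ ironedCurve (gridDist k q a) (q l) :=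
  (mul_le_mul_of_nonneg_left (G.le_quantileQuery hl) (G.q_pos hl).le).trans
    (G.revCurve_le_ironedCurve (G.q_mem (by omega)))

lemma ironedCurve_zero (G : IsGrid k q a) : ironedCurve (gridDist k q a) 0 = 0 := by
  refine le_antisymm ?_ ?_
  · simpa using G.ironedCurve_le_linear (t := 0) (by simp)
  · simpa [revCurve] using G.revCurve_le_ironedCurve (t := 0) (by simp)

lemma concaveOn_ironedCurve (G : IsGrid k q a) :
    ConcaveOn ℝ (Icc 0 1) (ironedCurve (gridDist k q a)) := by
  refine ⟨convex_Icc 0 1, fun x hx y hy α β hα hβ hab => ?_⟩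
  refine G.le_ironedCurve fun g h1 h2 => le_trans ?_ (h1.2 hx hy hα hβ hab)
  simp only [smul_eq_mul]
  gcongr
  · exact ironedCurve_le _ h1 h2 hx
  · exact ironedCurve_le _ h1 h2 hy

/-! ### Ironed virtual values -/

/-- The supremum of the slopes of the chords of the ironed revenue curve to the right of `x`. -/
def rightSlope (F : Measure ℝ) (x : ℝ) : EReal :=
  ⨆ t ∈ Ioc x 1, (((ironedCurve F t - ironedCurve F x) / (t - x) : ℝ) : EReal)

lemma ironedVirtualValue_eq (F : Measure ℝ) (z : ℝ) :
    ironedVirtualValue F z = rightSlope F (F.real (Ioi z)) := rfl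

lemma chord_le_rightSlope (F : Measure ℝ) {x t : ℝ} (ht : t ∈ Ioc x 1) :
    (((ironedCurve F t - ironedCurve F x) / (t - x) : ℝ) : EReal) ≤ rightSlope F x :=
  le_iSup₂ (f := fun t (_ : t ∈ Ioc x 1) =>
    (((ironedCurve F t - ironedCurve F x) / (t - x) : ℝ) : EReal)) t ht

/-- For a fixed right endpoint, chord slopes of a concave function decrease as the left endpoint
moves right. -/
lemma rightSlope_anti (G : IsGrid k q a) {x y : ℝ} (hx : 0 ≤ x) (hxy : x ≤ y) :
    rightSlope (gridDist k q a) y ≤ rightSlope (gridDist k q a) x := by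
  refine iSup₂_le fun t ht => ?_
  refine le_trans ?_ (chord_le_rightSlope _ ⟨hxy.trans_lt ht.1, ht.2⟩)
  rw [EReal.coe_le_coe_iff]
  have hc := G.concaveOn_ironedCurve.neg
  have h := hc.secant_mono (a := t) (x := x) (y := y) ⟨by linarith [ht.1], ht.2⟩
    ⟨hx, by linarith [ht.1, ht.2]⟩ ⟨by linarith, by linarith [ht.1, ht.2]⟩
    (by linarith [ht.1]) (by linarith [ht.1]) hxy
  simp only [Pi.neg_apply] at h
  have e : ∀ r : ℝ, (ironedCurve (gridDist k q a) t - ironedCurve (gridDist k q a) r) / (t - r) =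
      -((-ironedCurve (gridDist k q a) r - -ironedCurve (gridDist k q a) t) / (r - t)) := fun r => by
    rw [← neg_sub r t, div_neg, neg_sub_neg]
  rw [e, e]
  exact neg_le_neg h

lemma rightSlope_le (F : Measure ℝ) {x s : ℝ}
    (h : ∀ t ∈ Ioc x 1, ironedCurve F t - ironedCurve F x ≤ s * (t - x)) :
    rightSlope F x ≤ (s : EReal) :=
  iSup₂_le fun t ht => by
    rw [EReal.coe_le_coe_iff, div_le_iff₀ (by linarith [ht.1])]
    exact h t ht

lemma rightSlope_le_top_value (G : IsGrid k q a) {x : ℝ} (hx : 0 ≤ x) :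
    rightSlope (gridDist k q a) x ≤ (a k : EReal) :=
  (G.rightSlope_anti le_rfl hx).trans (rightSlope_le _ fun t ht => by
    have := G.ironedCurve_le_linear ⟨ht.1.le, ht.2⟩
    rw [G.ironedCurve_zero]
    linarith)

lemma monotone_ironedVirtualValue (G : IsGrid k q a) :
    Monotone (ironedVirtualValue (gridDist k q a)) := fun z w h => by
  have := G.isProbabilityMeasure_gridDist
  rw [ironedVirtualValue_eq, ironedVirtualValue_eq]
  exact G.rightSlope_anti measureReal_nonneg (measureReal_mono (Ioi_subset_Ioi h))

/-- The virtual value of `z` depends only on which grid values exceed `z`. -/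
lemma finite_range_ironedVirtualValue (G : IsGrid k q a) :
    (range (ironedVirtualValue (gridDist k q a))).Finite := by
  classical
  have hf : (range fun p : Fin (k + 1) → Prop => rightSlope (gridDist k q a)
      (∑ l : Fin (k + 1), if p l then q l - q (l + 1) else 0)).Finite := finite_range _
  refine hf.subset ?_
  rintro _ ⟨z, rfl⟩
  refine ⟨fun l => z < a l, ?_⟩
  rw [ironedVirtualValue_eq, G.gridDist_real measurableSet_Ioi, Finset.sum_range]
  simp only [indicator_apply, mem_Ioi]

lemma ironedVirtualValue_lt_top (G : IsGrid k q a) (z : ℝ) :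
    ironedVirtualValue (gridDist k q a) z < ⊤ :=
  (G.rightSlope_le_top_value (G.real_Ioi_mem z).1).trans_lt (EReal.coe_lt_top _)

lemma ironedVirtualValue_le (G : IsGrid k q a) (z : ℝ) :
    ironedVirtualValue (gridDist k q a) z ≤ (a k : EReal) :=
  G.rightSlope_le_top_value (G.real_Ioi_mem z).1

/-- The slope of the ironed revenue curve over the `l`-th grid cell. -/
def cellSlope (k : ℕ) (q a : ℕ → ℝ) (l : ℕ) : ℝ :=
  (ironedCurve (gridDist k q a) (q l) - ironedCurve (gridDist k q a) (q (l + 1))) /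
    (q l - q (l + 1))

lemma cellSlope_mul (G : IsGrid k q a) {l : ℕ} (hl : l ≤ k) :
    (q l - q (l + 1)) * cellSlope k q a l =
      ironedCurve (gridDist k q a) (q l) - ironedCurve (gridDist k q a) (q (l + 1)) := by
  have := G.q_lt l hl
  rw [cellSlope, mul_div_cancel₀]
  linarith

lemma cellSlope_mono (G : IsGrid k q a) {l : ℕ} (hl : l < k) :
    cellSlope k q a l ≤ cellSlope k q a (l + 1) :=
  G.concaveOn_ironedCurve.slope_anti_adjacent (G.q_mem (by omega)) (G.q_mem (by omega))
    (G.q_lt (l + 1) (by omega)) (G.q_lt l (by omega))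

/-- If `z ≥ a l` then `Pr[x > z] ≤ q (l+1)`, and the `l`-th cell is one of the chords starting at `q
(l+1)`. -/
lemma cellSlope_le_ironedVirtualValue (G : IsGrid k q a) {l : ℕ} (hl : l ≤ k) {z : ℝ}
    (hz : a l ≤ z) : (cellSlope k q a l : EReal) ≤ ironedVirtualValue (gridDist k q a) z :=
  (chord_le_rightSlope _ ⟨G.q_lt l hl, G.q_le_one (by omega)⟩).trans
    (G.rightSlope_anti (G.real_Ioi_mem z).1 (G.real_Ioi_le hl hz))

end IsGrid

namespace IsGrid

variable {k : ℕ} {q a : ℕ → ℝ}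

/-! ### Posted prices at a virtual reserve -/

/-- The expected excess of the cell slopes over `s` is at most the Legendre transform of the ironed
revenue curve at `s`. -/
lemma sum_posPart_cellSlope_le (G : IsGrid k q a) {s c : ℝ} (hc : 0 ≤ c)
    (h : ∀ t ∈ Icc (0 : ℝ) 1, ironedCurve (gridDist k q a) t - s * t ≤ c) {m : ℕ} (hm : m ≤ k + 1) :
    ∑ l ∈ Finset.Ico m (k + 1), (q l - q (l + 1)) * max (cellSlope k q a l - s) 0 ≤ c := by
  induction hm using Nat.decreasingInduction with
  | self => simpa using hc
  -- Slopes increase with the level. A slope below `s` contributes nothing; from the first slope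
  -- above `s` on, no term is truncated and the sum telescopes to `ironedCurve (q m) - s * q m`.
  | of_succ m hm ih =>
    rcases le_total (cellSlope k q a m) s with h1 | h1
    · rw [Finset.sum_eq_sum_Ico_succ_bot (by omega), max_eq_right (by linarith)]
      simpa using ih
    · have hmono : ∀ l ∈ Finset.Ico m (k + 1), s ≤ cellSlope k q a l := fun l hl => by
        rw [Finset.mem_Ico] at hl
        obtain ⟨hml, hlk⟩ := hl
        induction l, hml using Nat.le_induction with
        | base => exact h1
        | succ j hj ihj => exact (ihj (by omega)).trans (G.cellSlope_mono (by omega))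
      set d : ℕ → ℝ := fun l => ironedCurve (gridDist k q a) (q l) - s * q l with hd
      have hterm : ∀ l ∈ Finset.Ico m (k + 1),
          (q l - q (l + 1)) * max (cellSlope k q a l - s) 0 = -(d (l + 1) - d l) := fun l hl => by
        rw [max_eq_left (sub_nonneg.2 (hmono l hl)), mul_sub,
          G.cellSlope_mul (by rw [Finset.mem_Ico] at hl; omega)]
        simp only [hd]
        ring
      rw [Finset.sum_congr rfl hterm, Finset.sum_neg_distrib, Finset.sum_Ico_sub d (by omega)]
      have h2 := h (q m) (G.q_mem (by omega))
      simp only [hd, G.q_last, G.ironedCurve_zero]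
      linarith

lemma cellSlope_le_last (G : IsGrid k q a) {l : ℕ} (hl : l ≤ k) : cellSlope k q a l ≤ a k := by
  rw [← EReal.coe_le_coe_iff]
  exact (G.cellSlope_le_ironedVirtualValue hl (G.a_mono hl le_rfl)).trans
    (G.ironedVirtualValue_le _)

/-- Let `m` maximize `q l * (a l - s)`, with maximum `c`. The line `c + s t` lies above the ironed
curve and touches it at `q m`, so slopes are at least `s` before `q m` and at most `s` after. As `s`
is not a virtual value, winning means exactly `z ≥ a m`. The price `a m` sells with probability at
least `q m`, so the right side is at least `c`, which bounds the expected excess. -/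
lemma pricing_of_notMem_range (G : IsGrid k q a) (D : Measure ℝ) [IsProbabilityMeasure D]
    (hD : ∀ l ≤ k, q l ≤ D.real (Ici (a l))) {s : ℝ}
    (hs : (s : EReal) ∉ range (ironedVirtualValue (gridDist k q a))) :
    ∑ l ∈ Finset.range (k + 1), (q l - q (l + 1)) * max (cellSlope k q a l - s) 0 ≤
      D.real {z | (s : EReal) ≤ ironedVirtualValue (gridDist k q a) z} *
        (sInf {z | 0 ≤ z ∧ (s : EReal) ≤ ironedVirtualValue (gridDist k q a) z} - s) := by
  obtain ⟨m, hm, hmax⟩ := Finset.exists_max_image (Finset.range (k + 1))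
    (fun l => q l * (a l - s)) ⟨0, by simp⟩
  rw [Finset.mem_range, Nat.lt_succ_iff] at hm
  replace hmax : ∀ l ≤ k, q l * a l ≤ q m * (a m - s) + s * q l := fun l hl => by
    have := hmax l (by rw [Finset.mem_range]; omega)
    linarith
  set c := q m * (a m - s) with hcdef
  -- Above the top grid value nothing sells; the infimum over the empty set is irrelevant because it
  -- is multiplied by probability 0.
  rcases lt_or_ge (a k) s with hk | hk
  · have hempty : {z | (s : EReal) ≤ ironedVirtualValue (gridDist k q a) z} = ∅ := by
      ext z
      simp only [mem_ofPred_eq, mem_empty_iff_false, iff_false, not_le]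
      exact (G.ironedVirtualValue_le z).trans_lt (EReal.coe_lt_coe_iff.2 hk)
    rw [hempty, measureReal_empty, zero_mul]
    refine (Finset.sum_eq_zero fun l hl => ?_).le
    rw [max_eq_right, mul_zero]
    have := G.cellSlope_le_last (l := l) (by rw [Finset.mem_range] at hl; omega)
    linarith
  have hc : 0 ≤ c := by
    have h1 := hmax k le_rfl
    have := mul_nonneg (G.q_pos le_rfl).le (sub_nonneg.2 hk)
    linarith
  have hle : ∀ t ∈ Icc (0 : ℝ) 1, ironedCurve (gridDist k q a) t ≤ c + s * t :=
    fun t ht => G.ironedCurve_le_affine hc hmax ht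
  have htouch : c + s * q m ≤ ironedCurve (gridDist k q a) (q m) := by
    have := G.le_ironedCurve_q hm
    have e : c + s * q m = q m * a m := by rw [hcdef]; ring
    linarith
  have hwin : ∀ z, (s : EReal) ≤ ironedVirtualValue (gridDist k q a) z ↔ a m ≤ z := fun z => by
    constructor
    · intro h
      by_contra! hz
      refine hs ⟨z, le_antisymm ?_ h⟩
      rw [ironedVirtualValue_eq]
      refine (G.rightSlope_anti (G.q_nonneg (by omega)) (G.le_real_Ioi hm hz)).trans
        (rightSlope_le _ fun t ht => ?_)
      have := hle t ⟨(G.q_nonneg (by omega)).trans ht.1.le, ht.2⟩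
      linarith
    · intro h
      refine le_trans ?_ (G.cellSlope_le_ironedVirtualValue hm h)
      have hlt := G.q_lt m hm
      rw [EReal.coe_le_coe_iff, cellSlope, le_div_iff₀ (by linarith)]
      have := hle _ (G.q_mem (l := m + 1) (by omega))
      linarith
  have hset : {z | (s : EReal) ≤ ironedVirtualValue (gridDist k q a) z} = Ici (a m) := by
    ext z
    exact hwin z
  have hset' : {z | 0 ≤ z ∧ (s : EReal) ≤ ironedVirtualValue (gridDist k q a) z} = Ici (a m) := by
    ext z
    simp only [hwin, mem_ofPred_eq, mem_Ici, and_iff_right_iff_imp]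
    exact fun h => (G.a_nonneg hm).trans h
  rw [hset, hset', csInf_Ici]
  have hs : s ≤ a m := by
    by_contra! h
    have := mul_neg_of_pos_of_neg (G.q_pos hm) (sub_neg.2 h)
    linarith
  have h1 := G.sum_posPart_cellSlope_le (m := 0) (s := s) hc
    (fun t ht => by linarith [hle t ht]) (by omega)
  rw [← Finset.range_eq_Ico] at h1
  exact h1.trans (mul_le_mul_of_nonneg_right (hD m hm) (by linarith))

lemma eventually_coe_lt_iff (y : EReal) (s : ℝ) :
    (∀ᶠ r : ℝ in 𝓝[<] s, ((r : EReal) ≤ y ↔ (s : EReal) ≤ y) ∧ (r : EReal) ≠ y) ∧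
      ∀ᶠ r : ℝ in 𝓝[>] s, ((r : EReal) ≤ y ↔ (s : EReal) < y) ∧ (r : EReal) ≠ y := by
  have hc : Tendsto (fun r : ℝ => (r : EReal)) (𝓝 s) (𝓝 (s : EReal)) :=
    continuous_coe_real_ereal.tendsto s
  constructor
  · rcases lt_or_ge y s with h | h
    · filter_upwards [(hc.mono_left nhdsWithin_le_nhds).eventually_const_lt h] with r hr
      exact ⟨iff_of_false (not_le.2 hr) (not_le.2 h), hr.ne'⟩
    · filter_upwards [self_mem_nhdsWithin] with r hr
      have : (r : EReal) < y := (EReal.coe_lt_coe_iff.2 hr).trans_le h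
      exact ⟨iff_of_true this.le h, this.ne⟩
  · rcases le_or_gt y s with h | h
    · filter_upwards [self_mem_nhdsWithin] with r hr
      have : y < (r : EReal) := h.trans_lt (EReal.coe_lt_coe_iff.2 hr)
      exact ⟨iff_of_false (not_le.2 this) (not_lt.2 h), this.ne'⟩
    · filter_upwards [(hc.mono_left nhdsWithin_le_nhds).eventually_lt_const h] with r hr
      exact ⟨iff_of_true hr.le h, hr.ne⟩

/-- Selling at the smallest price whose ironed virtual value (weakly or strictly) exceeds `s` earns at
least `s` per sale plus the expected excess of the cell slopes over `s`. -/
lemma pricing (G : IsGrid k q a) (D : Measure ℝ) [IsProbabilityMeasure D]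
    (hD : ∀ l ≤ k, q l ≤ D.real (Ici (a l))) (s : ℝ) {W : Set ℝ}
    (hW : W = {z | (s : EReal) ≤ ironedVirtualValue (gridDist k q a) z} ∨
      W = {z | (s : EReal) < ironedVirtualValue (gridDist k q a) z}) :
    ∑ l ∈ Finset.range (k + 1), (q l - q (l + 1)) * max (cellSlope k q a l - s) 0 ≤
      D.real W * (sInf {z | 0 ≤ z ∧ z ∈ W} - s) := by
  have hfin := G.finite_range_ironedVirtualValue
  -- Approach `s` from the left for the weak winning rule and from the right for the strict one.
  -- There are finitely many virtual values, so nearby thresholds avoid them all and give the same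
  -- set `W`.
  obtain ⟨f, hf, hne, hev⟩ : ∃ f : Filter ℝ, f ≤ 𝓝 s ∧ f.NeBot ∧
      ∀ᶠ r : ℝ in f, ∀ y ∈ range (ironedVirtualValue (gridDist k q a)),
        ((r : EReal) ≤ y ↔ y ∈ if W = {z | (s : EReal) ≤ ironedVirtualValue (gridDist k q a) z}
          then Ici (s : EReal) else Ioi (s : EReal)) ∧ (r : EReal) ≠ y := by
    split_ifs with h
    · exact ⟨𝓝[<] s, nhdsWithin_le_nhds, inferInstance,
        (eventually_all_finite hfin).2 fun y _ => (eventually_coe_lt_iff y s).1⟩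
    · exact ⟨𝓝[>] s, nhdsWithin_le_nhds, inferInstance,
        (eventually_all_finite hfin).2 fun y _ => (eventually_coe_lt_iff y s).2⟩
  have hmem : ∀ z, ironedVirtualValue (gridDist k q a) z ∈
      (if W = {z | (s : EReal) ≤ ironedVirtualValue (gridDist k q a) z}
        then Ici (s : EReal) else Ioi (s : EReal)) ↔ z ∈ W := fun z => by
    split_ifs with h
    · rw [h]; rfl
    · rw [hW.resolve_left h]; rfl
  have hlim : Tendsto (fun r : ℝ => ∑ l ∈ Finset.range (k + 1),
      (q l - q (l + 1)) * max (cellSlope k q a l - r) 0) f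
      (𝓝 (∑ l ∈ Finset.range (k + 1), (q l - q (l + 1)) * max (cellSlope k q a l - s) 0)) :=
    ((by fun_prop : Continuous fun r : ℝ => ∑ l ∈ Finset.range (k + 1),
      (q l - q (l + 1)) * max (cellSlope k q a l - r) 0).tendsto s).mono_left hf
  have hlim' : Tendsto (fun r : ℝ => D.real W * (sInf {z | 0 ≤ z ∧ z ∈ W} - r)) f
      (𝓝 (D.real W * (sInf {z | 0 ≤ z ∧ z ∈ W} - s))) :=
    ((by fun_prop : Continuous fun r : ℝ =>
      D.real W * (sInf {z | 0 ≤ z ∧ z ∈ W} - r)).tendsto s).mono_left hf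
  refine le_of_tendsto_of_tendsto hlim hlim' ?_
  filter_upwards [hev] with r hr
  have hiff : ∀ z, (r : EReal) ≤ ironedVirtualValue (gridDist k q a) z ↔ z ∈ W := fun z =>
    (hr _ ⟨z, rfl⟩).1.trans (hmem z)
  have h := G.pricing_of_notMem_range D hD (s := r) (by
    rintro ⟨z, hz⟩
    exact (hr _ ⟨z, rfl⟩).2 hz.symm)
  simp only [hiff] at h
  exact h

/-- Summation by parts: posted-price revenues are bounded by expected cell slopes. -/
lemma sum_abel (G : IsGrid k q a) {x : ℕ → ℝ} (hx0 : 0 ≤ x 0) (hx : ∀ l < k, x l ≤ x (l + 1)) :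
    q 0 * a 0 * x 0 + ∑ l ∈ Finset.range k, q (l + 1) * a (l + 1) * (x (l + 1) - x l) ≤
      ∑ l ∈ Finset.range (k + 1), (q l - q (l + 1)) * cellSlope k q a l * x l := by
  set R : ℕ → ℝ := fun l => ironedCurve (gridDist k q a) (q l) with hR
  have h1 : q 0 * a 0 * x 0 + ∑ l ∈ Finset.range k, q (l + 1) * a (l + 1) * (x (l + 1) - x l) ≤
      R 0 * x 0 + ∑ l ∈ Finset.range k, R (l + 1) * (x (l + 1) - x l) := by
    gcongr with l hl
    · exact G.le_ironedCurve_q (Nat.zero_le k)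
    · rw [Finset.mem_range] at hl
      exact sub_nonneg.2 (hx l hl)
    · rw [Finset.mem_range] at hl
      exact G.le_ironedCurve_q (l := l + 1) hl
  have h2 : ∀ m, R 0 * x 0 + ∑ l ∈ Finset.range m, R (l + 1) * (x (l + 1) - x l) =
      ∑ l ∈ Finset.range (m + 1), (R l - R (l + 1)) * x l + R (m + 1) * x m := fun m => by
    induction m with
    | zero => simp; ring
    | succ m ih =>
      rw [Finset.sum_range_succ, ← add_assoc, ih, Finset.sum_range_succ _ (m + 1)]
      ring
  have h3 : R (k + 1) = 0 := by simp only [hR, G.q_last, G.ironedCurve_zero]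
  rw [h2, h3, zero_mul, add_zero] at h1
  refine h1.trans (Finset.sum_le_sum fun l hl => ?_)
  rw [G.cellSlope_mul (by rw [Finset.mem_range] at hl; omega)]

end IsGrid

/-! ### Truthfulness of Myerson's mechanism -/

section truthful

variable {F : Fin n → Measure ℝ}

lemma MyersonWins.update_mono (hφ : ∀ i, Monotone (ironedVirtualValue (F i))) {b : Fin n → ℝ}
    {i : Fin n} {z w : ℝ} (hzw : z ≤ w) (h : MyersonWins F (Function.update b i z) i) :
    MyersonWins F (Function.update b i w) i := by
  obtain ⟨h1, h2, h3⟩ := h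
  simp only [Function.update_self] at h1 h2 h3
  have hm := hφ i hzw
  refine ⟨by simpa using h1.trans hm, fun j => ?_, fun j hj => ?_⟩
  · by_cases hji : j = i
    · rw [hji]
    · have := h2 j
      rw [Function.update_of_ne hji] at this
      rw [Function.update_of_ne hji, Function.update_self]
      exact this.trans hm
  · have := h3 j hj
    rw [Function.update_of_ne hj.ne] at this
    rw [Function.update_of_ne hj.ne, Function.update_self]
    exact this.trans_le hm

lemma MyersonWins.eq {b : Fin n → ℝ} {i j : Fin n} (hi : MyersonWins F b i)
    (hj : MyersonWins F b j) : i = j := by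
  rcases lt_trichotomy i j with h | h | h
  · exact absurd (hi.2.1 j) (not_le.2 (hj.2.2 i h))
  · exact h
  · exact absurd (hj.2.1 i) (not_le.2 (hi.2.2 j h))

lemma exists_myersonWins {b : Fin n → ℝ} {w : Fin n} (hw : 0 ≤ ironedVirtualValue (F w) (b w)) :
    ∃ i, MyersonWins F b i := by
  classical
  set φ : Fin n → EReal := fun j => ironedVirtualValue (F j) (b j) with hφ
  obtain ⟨i, -, hi⟩ := Finset.exists_max_image Finset.univ φ ⟨w, Finset.mem_univ w⟩
  set A := Finset.univ.filter fun j => φ j = φ i with hA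
  have hne : A.Nonempty := ⟨i, by simp [hA]⟩
  have hmin : φ (A.min' hne) = φ i := (Finset.mem_filter.1 (A.min'_mem hne)).2
  refine ⟨A.min' hne, ?_, fun j => ?_, fun j hj => ?_⟩
  · exact (hw.trans (hi w (Finset.mem_univ w))).trans hmin.ge
  · exact (hi j (Finset.mem_univ j)).trans hmin.ge
  · refine lt_of_le_of_ne ((hi j (Finset.mem_univ j)).trans hmin.ge) fun h => ?_
    exact absurd (A.min'_le j (by simp only [hA, Finset.mem_filter, Finset.mem_univ, true_and]
                                  exact h.trans hmin)) (not_le.2 hj)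

lemma myerson_feasible (F : Fin n → Measure ℝ) : (myerson F).Feasible := by
  intro b
  refine ⟨fun i => ?_, ?_⟩
  · simp only [myerson]
    split_ifs <;> norm_num
  · by_cases h : ∃ i, MyersonWins F b i
    · obtain ⟨i, hi⟩ := h
      rw [Finset.sum_eq_single i]
      · simp [myerson, hi]
      · intro j _ hj
        simp only [myerson, if_neg fun h => hj (MyersonWins.eq h hi)]
      · simp
    · push Not at h
      simp [myerson, h]

lemma sInf_threshold_le {b : Fin n → ℝ} {i : Fin n} {v : ℝ} (hv : 0 ≤ v)
    (h : MyersonWins F (Function.update b i v) i) :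
    sInf {z : ℝ | 0 ≤ z ∧ MyersonWins F (Function.update b i z) i} ≤ v :=
  csInf_le ⟨0, fun _ hz => hz.1⟩ ⟨hv, h⟩

lemma myerson_exPostIR (F : Fin n → Measure ℝ) : (myerson F).ExPostIR := by
  intro i b hb
  simp only [myerson]
  split_ifs with h
  · have := sInf_threshold_le hb (by rwa [Function.update_eq_self])
    linarith
  · simp

lemma myerson_dsic (hφ : ∀ i, Monotone (ironedVirtualValue (F i))) : (myerson F).DSIC := by
  intro i b v hv
  simp only [myerson, Function.update_idem]
  by_cases h1 : MyersonWins F b i <;> by_cases h2 : MyersonWins F (Function.update b i v) i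
  · simp [h1, h2]
  · simp only [h1, h2, if_true, if_false]
    have hlt : ∀ z, MyersonWins F (Function.update b i z) i → v < z := fun z hz => by
      by_contra! hzv
      exact h2 (hz.update_mono hφ hzv)
    have h1' : MyersonWins F (Function.update b i (b i)) i := by rwa [Function.update_eq_self]
    have : v ≤ sInf {z : ℝ | 0 ≤ z ∧ MyersonWins F (Function.update b i z) i} :=
      le_csInf ⟨b i, hv.trans (hlt _ h1').le, h1'⟩ fun z hz => (hlt z hz.2).le
    linarith
  · simp only [h1, h2, if_true, if_false]
    have := sInf_threshold_le hv h2
    linarith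
  · simp [h1, h2]

end truthful

/-! ### Functions of finitely many labels -/

/-- Threshold payments are infima with no evident measurability. They depend only on the
finite-valued profile of virtual values, which yields measurability here and boundedness next. -/
lemma measurable_of_finite_range {X Y : Type*} [MeasurableSpace X] [MeasurableSpace Y]
    [MeasurableSingletonClass Y] {l : X → Y} (hl : Measurable l) (hfin : (range l).Finite)
    {f : X → ℝ} (hf : ∀ x y, l x = l y → f x = f y) : Measurable f := by
  intro s _
  have : f ⁻¹' s = ⋃ y ∈ l '' (f ⁻¹' s), l ⁻¹' {y} := by
    ext x
    simp only [mem_preimage, mem_image, mem_iUnion, mem_singleton_iff, exists_prop]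
    constructor
    · exact fun h => ⟨l x, ⟨x, h, rfl⟩, rfl⟩
    · rintro ⟨_, ⟨x', hx', rfl⟩, h⟩
      rwa [hf x x' h]
  rw [this]
  exact (hfin.subset (image_subset_range _ _)).measurableSet_biUnion fun y _ =>
    hl (measurableSet_singleton y)

lemma exists_bound_of_finite_range {X Y : Type*} {l : X → Y} (hfin : (range l).Finite)
    {f : X → ℝ} (hf : ∀ x y, l x = l y → f x = f y) : ∃ C, ∀ x, |f x| ≤ C := by
  have hr : (range f).Finite := by
    refine (hfin.image (Function.extend l f 0)).subset ?_
    rintro _ ⟨x, rfl⟩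
    exact ⟨l x, ⟨x, rfl⟩, Function.FactorsThrough.extend_apply (fun a b h => hf a b h) 0 x⟩
  obtain ⟨C, hC⟩ := hr.isBounded.exists_norm_le
  exact ⟨C, fun x => hC _ ⟨x, rfl⟩⟩

/-! ### Revenue of Myerson's mechanism on a dominating prior -/

/-- The virtual value that player `i` has to beat: the highest ironed virtual value of the others, or
zero. -/
def rival (F : Fin n → Measure ℝ) (b : Fin n → ℝ) (i : Fin n) : EReal :=
  ((Finset.univ.erase i).sup fun j => ironedVirtualValue (F j) (b j)) ⊔ 0

section revenue

variable {F : Fin n → Measure ℝ}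

lemma rival_le_iff {b : Fin n → ℝ} {i : Fin n} {y : EReal} :
    rival F b i ≤ y ↔ 0 ≤ y ∧ ∀ j, j ≠ i → ironedVirtualValue (F j) (b j) ≤ y := by
  simp [rival, and_comm]

lemma rival_nonneg (b : Fin n → ℝ) (i : Fin n) : 0 ≤ rival F b i := (rival_le_iff.1 le_rfl).1

lemma le_rival (b : Fin n → ℝ) {i j : Fin n} (h : j ≠ i) :
    ironedVirtualValue (F j) (b j) ≤ rival F b i := (rival_le_iff.1 le_rfl).2 j h

lemma rival_update (b : Fin n → ℝ) (i : Fin n) (z : ℝ) :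
    rival F (Function.update b i z) i = rival F b i := by
  rw [rival, rival]
  congr 1
  refine Finset.sup_congr rfl fun j hj => ?_
  rw [Function.update_of_ne (Finset.ne_of_mem_erase hj)]

lemma coe_toReal_rival (htop : ∀ i z, ironedVirtualValue (F i) z < ⊤) (b : Fin n → ℝ) (i : Fin n) :
    ((rival F b i).toReal : EReal) = rival F b i := by
  refine EReal.coe_toReal (ne_of_lt ?_) (ne_of_gt (EReal.bot_lt_zero.trans_le (rival_nonneg b i)))
  rw [rival, max_lt_iff, Finset.sup_lt_iff bot_lt_top]
  exact ⟨fun j _ => htop j _, EReal.zero_lt_top⟩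

lemma toReal_rival_nonneg (b : Fin n → ℝ) (i : Fin n) : 0 ≤ (rival F b i).toReal :=
  EReal.toReal_nonneg (rival_nonneg b i)

/-- If a smaller index attains the rival value, a tie loses and the comparison is strict; otherwise
a tie wins. The choice depends only on the other players. -/
lemma myersonWins_update_iff (b : Fin n → ℝ) (i : Fin n) :
    (∀ z, MyersonWins F (Function.update b i z) i ↔ rival F b i ≤ ironedVirtualValue (F i) z) ∨
      ∀ z, MyersonWins F (Function.update b i z) i ↔ rival F b i < ironedVirtualValue (F i) z := by
  have key : ∀ z, MyersonWins F (Function.update b i z) i ↔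
      rival F b i ≤ ironedVirtualValue (F i) z ∧
        ∀ j < i, ironedVirtualValue (F j) (b j) < ironedVirtualValue (F i) z := fun z => by
    rw [rival_le_iff, MyersonWins, Function.update_self, and_assoc]
    refine and_congr_right fun _ => and_congr ?_ ?_
    · refine forall_congr' fun j => ?_
      by_cases hj : j = i
      · subst hj
        simp
      · simp [hj]
    · refine forall₂_congr fun j hj => ?_
      rw [Function.update_of_ne hj.ne]
  by_cases h : ∃ j < i, ironedVirtualValue (F j) (b j) = rival F b i
  · right
    intro z
    obtain ⟨j, hj, hji⟩ := h
    rw [key]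
    exact ⟨fun h => hji ▸ h.2 j hj, fun h => ⟨h.le, fun j hj => (le_rival b hj.ne).trans_lt h⟩⟩
  · left
    intro z
    push Not at h
    rw [key]
    exact ⟨fun h => h.1, fun h' => ⟨h', fun j hj =>
      (lt_of_le_of_ne (le_rival b hj.ne) (h j hj)).trans_le h'⟩⟩

/-- The profile of ironed virtual values. -/
def virtualProfile (F : Fin n → Measure ℝ) (b : Fin n → ℝ) : Fin n → EReal :=
  fun i => ironedVirtualValue (F i) (b i)

lemma measurable_virtualProfile (hφ : ∀ i, Monotone (ironedVirtualValue (F i))) :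
    Measurable (virtualProfile F) :=
  measurable_pi_lambda _ fun i => (hφ i).measurable.comp (measurable_pi_apply i)

lemma finite_range_virtualProfile (hfin : ∀ i, (range (ironedVirtualValue (F i))).Finite) :
    (range (virtualProfile F)).Finite := by
  refine (Set.Finite.pi' hfin).subset ?_
  rintro _ ⟨b, rfl⟩ i
  exact ⟨b i, rfl⟩

lemma virtualProfile_update (b : Fin n → ℝ) (i : Fin n) (z : ℝ) :
    virtualProfile F (Function.update b i z) =
      Function.update (virtualProfile F b) i (ironedVirtualValue (F i) z) := by
  funext j
  by_cases hj : j = i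
  · subst hj
    simp [virtualProfile]
  · simp [virtualProfile, Function.update_of_ne hj]

lemma myersonWins_congr {b b' : Fin n → ℝ} (h : virtualProfile F b = virtualProfile F b')
    (i : Fin n) : MyersonWins F b i ↔ MyersonWins F b' i := by
  have : ∀ b, MyersonWins F b i ↔ 0 ≤ virtualProfile F b i ∧
      (∀ j, virtualProfile F b j ≤ virtualProfile F b i) ∧
        ∀ j < i, virtualProfile F b j < virtualProfile F b i := fun _ => Iff.rfl
  rw [this, this, h]

lemma rival_congr {b b' : Fin n → ℝ} (h : virtualProfile F b = virtualProfile F b')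
    (i : Fin n) : rival F b i = rival F b' i := by
  have : ∀ b, rival F b i = ((Finset.univ.erase i).sup (virtualProfile F b)) ⊔ 0 := fun _ => rfl
  rw [this, this, h]

lemma myerson_pay_congr {b b' : Fin n → ℝ} (h : virtualProfile F b = virtualProfile F b')
    (i : Fin n) : (myerson F).pay b i = (myerson F).pay b' i := by
  have h1 : ∀ z, MyersonWins F (Function.update b i z) i ↔
      MyersonWins F (Function.update b' i z) i := fun z =>
    myersonWins_congr (by rw [virtualProfile_update, virtualProfile_update, h]) i
  simp only [myerson, h1]
  classical exact if_congr (myersonWins_congr h i) rfl rfl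

lemma integrable_of_virtualProfile {X : Type*} [MeasurableSpace X] {μ : Measure X}
    [IsFiniteMeasure μ] (hφ : ∀ i, Monotone (ironedVirtualValue (F i)))
    (hfin : ∀ i, (range (ironedVirtualValue (F i))).Finite) {V : X → Fin n → ℝ} (hV : Measurable V)
    {f : (Fin n → ℝ) → ℝ} (hf : ∀ b b', virtualProfile F b = virtualProfile F b' → f b = f b') :
    Integrable (fun x => f (V x)) μ := by
  obtain ⟨C, hC⟩ := exists_bound_of_finite_range (finite_range_virtualProfile hfin) hf
  exact Integrable.of_bound ((measurable_of_finite_range (measurable_virtualProfile hφ)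
    (finite_range_virtualProfile hfin) hf).comp hV).aestronglyMeasurable C
    (ae_of_all _ fun x => hC _)

lemma integrable_myerson_revAt (D : Fin n → Measure ℝ) [∀ i, IsProbabilityMeasure (D i)]
    (hφ : ∀ i, Monotone (ironedVirtualValue (F i)))
    (hfin : ∀ i, (range (ironedVirtualValue (F i))).Finite) :
    Integrable (myerson F).revAt (Measure.pi D) :=
  integrable_of_virtualProfile hφ hfin (V := fun b => b) measurable_id
    (f := (myerson F).revAt) fun _ _ h =>
      Finset.sum_congr rfl fun i _ => myerson_pay_congr h i

/-- Values as functions of independent uniform quantiles. -/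
def valuesAt (D : Fin n → Measure ℝ) (u : Fin n → ℝ) : Fin n → ℝ :=
  fun i => quantileQuery (D i) (u i)

lemma valuesAt_update (D : Fin n → Measure ℝ) (u : Fin n → ℝ) (i : Fin n) (t : ℝ) :
    valuesAt D (Function.update u i t) =
      Function.update (valuesAt D u) i (quantileQuery (D i) t) := by
  funext j
  by_cases hj : j = i
  · subst hj
    simp [valuesAt]
  · simp [valuesAt, Function.update_of_ne hj]

lemma measurePreserving_valuesAt (D : Fin n → Measure ℝ) [∀ i, IsProbabilityMeasure (D i)]
    (hD : ∀ i, D i (Iio 0) = 0) :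
    MeasurePreserving (valuesAt D) (Measure.pi fun _ => unifDist) (Measure.pi D) :=
  measurePreserving_pi (fun _ => unifDist) D fun i =>
    measurePreserving_quantileQuery (D i) (hD i)

open Classical in
/-- The revenue credited to player `i` in the lower bound: the rival virtual value upon winning, plus
the excess of the player's learned virtual value. -/
def credit (F D : Fin n → Measure ℝ) (ψ : Fin n → ℝ → ℝ) (i : Fin n) (u : Fin n → ℝ) : ℝ :=
  (if MyersonWins F (valuesAt D u) i then (rival F (valuesAt D u) i).toReal else 0) +
    max (ψ i (u i) - (rival F (valuesAt D u) i).toReal) 0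

/-- If `w` wins, its own credit `s + (ψ - s)⁺` is at least `ψ`. Otherwise the virtual value of `w`
is at most the winner's rival value, which is credited to the winner. -/
lemma le_sum_credit (htop : ∀ i z, ironedVirtualValue (F i) z < ⊤) {D : Fin n → Measure ℝ}
    {ψ : Fin n → ℝ → ℝ}
    (hψ : ∀ i u, 0 < ψ i u → (ψ i u : EReal) ≤ ironedVirtualValue (F i) (quantileQuery (D i) u))
    (u : Fin n → ℝ) (w : Fin n) : max (ψ w (u w)) 0 ≤ ∑ i, credit F D ψ i u := by
  classical
  have hnn : ∀ i, 0 ≤ credit F D ψ i u := fun i => by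
    refine add_nonneg ?_ (le_max_right _ _)
    split_ifs
    exacts [toReal_rival_nonneg _ _, le_rfl]
  refine max_le ?_ (Finset.sum_nonneg fun i _ => hnn i)
  rcases le_or_gt (ψ w (u w)) 0 with h0 | h0
  · exact h0.trans (Finset.sum_nonneg fun i _ => hnn i)
  have h1 := hψ w (u w) h0
  have h2 : 0 ≤ ironedVirtualValue (F w) (valuesAt D u w) :=
    le_trans (by exact_mod_cast h0.le) h1
  obtain ⟨i, hi⟩ := exists_myersonWins h2
  refine le_trans ?_ (Finset.single_le_sum (fun i _ => hnn i) (Finset.mem_univ i))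
  rw [credit, if_pos hi]
  by_cases hiw : i = w
  · subst hiw
    linarith [le_max_left (ψ i (u i) - (rival F (valuesAt D u) i).toReal) 0]
  · have : ψ w (u w) ≤ (rival F (valuesAt D u) i).toReal := by
      rw [← EReal.coe_le_coe_iff, coe_toReal_rival htop]
      have h3 := le_rival (F := F) (valuesAt D u) (Ne.symm hiw)
      exact h1.trans h3
    linarith [le_max_right (ψ i (u i) - (rival F (valuesAt D u) i).toReal) 0]

/-- Strong revenue monotonicity: on a prior `D`, Myerson's mechanism for `F` earns at least the expected
learned virtual welfare of any feasible allocation. -/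
theorem le_myerson_rev (D : Fin n → Measure ℝ) [∀ i, IsProbabilityMeasure (D i)]
    (hD : ∀ i, D i (Iio 0) = 0)
    (hφ : ∀ i, Monotone (ironedVirtualValue (F i)))
    (hfin : ∀ i, (range (ironedVirtualValue (F i))).Finite)
    (htop : ∀ i z, ironedVirtualValue (F i) z < ⊤)
    {ψ : Fin n → ℝ → ℝ} (hψm : ∀ i, Measurable (ψ i)) {C : ℝ} (hψC : ∀ i u, |ψ i u| ≤ C)
    (hψ : ∀ i u, 0 < ψ i u → (ψ i u : EReal) ≤ ironedVirtualValue (F i) (quantileQuery (D i) u))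
    (hprice : ∀ (i : Fin n) (s : ℝ) (W : Set ℝ),
      (W = {z | (s : EReal) ≤ ironedVirtualValue (F i) z} ∨
        W = {z | (s : EReal) < ironedVirtualValue (F i) z}) →
      ∫ u, max (ψ i u - s) 0 ∂unifDist ≤ (D i).real W * (sInf {z | 0 ≤ z ∧ z ∈ W} - s))
    {x : (Fin n → ℝ) → Fin n → ℝ} (hx : ∀ i, Measurable fun u => x u i)
    (hx0 : ∀ u i, 0 ≤ x u i) (hx1 : ∀ u, ∑ i, x u i ≤ 1) :
    ∫ u, ∑ i, max (ψ i (u i)) 0 * x u i ∂(Measure.pi fun _ => unifDist) ≤ (myerson F).rev D := by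
  classical
  set μ : Measure (Fin n → ℝ) := Measure.pi fun _ => unifDist with hμ
  have hV := measurePreserving_valuesAt D hD
  set f : Fin n → (Fin n → ℝ) → ℝ := fun i u => (myerson F).pay (valuesAt D u) i with hf
  have hfint : ∀ i, Integrable (f i) μ := fun i =>
    integrable_of_virtualProfile hφ hfin hV.measurable (f := fun b => (myerson F).pay b i)
      fun _ _ h => myerson_pay_congr h i
  have hrint : ∀ i, Integrable (fun u => (rival F (valuesAt D u) i).toReal) μ := fun i =>
    integrable_of_virtualProfile hφ hfin hV.measurable (f := fun b => (rival F b i).toReal)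
      fun _ _ h => by rw [rival_congr h]
  have hψint : ∀ i, Integrable (fun u : Fin n → ℝ => ψ i (u i)) μ := fun i =>
    Integrable.of_bound ((hψm i).comp (measurable_pi_apply i)).aestronglyMeasurable C
      (ae_of_all _ fun u => hψC i _)
  have hψint' : ∀ i, Integrable (ψ i) unifDist := fun i =>
    Integrable.of_bound (hψm i).aestronglyMeasurable C (ae_of_all _ fun u => hψC i _)
  have hgint : ∀ i, Integrable (credit F D ψ i) μ := fun i =>
    (integrable_of_virtualProfile hφ hfin hV.measurable
      (f := fun b => if MyersonWins F b i then (rival F b i).toReal else 0)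
      fun _ _ h => by simp only [rival_congr h, myersonWins_congr h]).add
      (((hψint i).sub (hrint i)).sup (integrable_zero _ _ _))
  -- Resample coordinate `i` alone: the rival value and the winning set `W` are then constants, and
  -- `hprice` applies.
  have hfg : ∀ i, ∫ u, credit F D ψ i u ∂μ ≤ ∫ u, f i u ∂μ := fun i => by
    rw [integral_eq_integral_integral_update i (hfint i),
      integral_eq_integral_integral_update i (hgint i)]
    refine integral_mono (integrable_update i (hgint i)).integral_prod_left
      (integrable_update i (hfint i)).integral_prod_left fun u => ?_
    set b := valuesAt D u with hb
    set s := (rival F b i).toReal with hs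
    set W : Set ℝ := {z | MyersonWins F (Function.update b i z) i} with hW
    have hWs : W = {z | (s : EReal) ≤ ironedVirtualValue (F i) z} ∨
        W = {z | (s : EReal) < ironedVirtualValue (F i) z} := by
      rw [hs, coe_toReal_rival htop]
      exact (myersonWins_update_iff b i).imp (fun h => Set.ext h) fun h => Set.ext h
    have hWm : MeasurableSet W := by
      rcases hWs with h | h <;> rw [h]
      · exact measurableSet_le measurable_const (hφ i).measurable
      · exact measurableSet_lt measurable_const (hφ i).measurable
    have hQ := measurePreserving_quantileQuery (D i) (hD i)
    have hind : ∀ c : ℝ, ∫ t, (quantileQuery (D i) ⁻¹' W).indicator (fun _ => c) t ∂unifDist =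
        (D i).real W * c := fun c => by
      rw [integral_indicator (hQ.measurable hWm), setIntegral_const, smul_eq_mul,
        measureReal_def, hQ.measure_preimage hWm.nullMeasurableSet, ← measureReal_def]
    have h1 : ∫ t, f i (Function.update u i t) ∂unifDist =
        (D i).real W * sInf {z | 0 ≤ z ∧ z ∈ W} := by
      rw [← hind]
      refine integral_congr_ae (ae_of_all _ fun t => ?_)
      simp only [hf, valuesAt_update, myerson, Function.update_idem, indicator_apply]
      rfl
    have h2 : ∫ t, credit F D ψ i (Function.update u i t) ∂unifDist =
        (D i).real W * s + ∫ t, max (ψ i t - s) 0 ∂unifDist := by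
      rw [← hind, ← integral_add]
      · refine integral_congr_ae (ae_of_all _ fun t => ?_)
        simp only [credit, valuesAt_update, rival_update, indicator_apply, Function.update_self]
        rfl
      · exact (integrable_const _).indicator (hQ.measurable hWm)
      · exact ((hψint' i).sub (integrable_const _)).sup (integrable_zero _ _ _)
    simp only [h1, h2]
    have := hprice i s W hWs
    linarith
  have hrev : (myerson F).rev D = ∑ i, ∫ u, f i u ∂μ := by
    rw [Mechanism.rev, ← hV.map_eq, integral_map hV.measurable.aemeasurable,
      ← integral_finsetSum _ fun i _ => hfint i]
    · rfl
    · rw [hV.map_eq]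
      exact (integrable_myerson_revAt D hφ hfin).aestronglyMeasurable
  rw [hrev]
  refine le_trans ?_ (Finset.sum_le_sum fun i _ => hfg i)
  rw [← integral_finsetSum _ fun i _ => hgint i]
  refine integral_mono (integrable_finsetSum _ fun i _ => ?_)
    (integrable_finsetSum _ fun i _ => hgint i) fun u => ?_
  · refine Integrable.mul_bdd (c := 1) ((hψint i).sup (integrable_zero _ _ _))
      (hx i).aestronglyMeasurable (ae_of_all _ fun u => ?_)
    rw [Real.norm_of_nonneg (hx0 u i)]
    exact (Finset.single_le_sum (fun i _ => hx0 u i) (Finset.mem_univ i)).trans (hx1 u)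
  · calc ∑ i, max (ψ i (u i)) 0 * x u i ≤ ∑ i, (∑ j, credit F D ψ j u) * x u i :=
          Finset.sum_le_sum fun i _ =>
            mul_le_mul_of_nonneg_right (le_sum_credit htop hψ u i) (hx0 u i)
      _ = (∑ j, credit F D ψ j u) * ∑ i, x u i := by rw [Finset.mul_sum]
      _ ≤ ∑ j, credit F D ψ j u := by
          refine mul_le_of_le_one_right ?_ (hx1 u)
          refine Finset.sum_nonneg fun i _ => add_nonneg ?_ (le_max_right _ _)
          split_ifs
          exacts [toReal_rival_nonneg _ _, le_rfl]

end revenue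

/-! ### Step functions on a quantile grid -/

/-- The function equal to `c l` on the `l`-th cell `(q (l + 1), q l]`, for `l ≤ k`, and zero
elsewhere. -/
def cellFun (k : ℕ) (q c : ℕ → ℝ) (u : ℝ) : ℝ :=
  ∑ l ∈ Finset.range (k + 1), (Ioc (q (l + 1)) (q l)).indicator (fun _ => c l) u

lemma measurable_cellFun (k : ℕ) (q c : ℕ → ℝ) : Measurable (cellFun k q c) :=
  Finset.measurable_fun_sum _ fun _ _ => measurable_const.indicator measurableSet_Ioc

lemma abs_cellFun_le (k : ℕ) (q c : ℕ → ℝ) (u : ℝ) :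
    |cellFun k q c u| ≤ ∑ l ∈ Finset.range (k + 1), |c l| := by
  refine (Finset.abs_sum_le_sum_abs _ _).trans (Finset.sum_le_sum fun l _ => ?_)
  by_cases h : u ∈ Ioc (q (l + 1)) (q l)
  · rw [indicator_of_mem h]
  · rw [indicator_of_notMem h]
    simp

namespace IsGrid

variable {k : ℕ} {q a : ℕ → ℝ}

lemma level_unique (G : IsGrid k q a) {l m : ℕ} (hl : l ≤ k) (hm : m ≤ k) {u : ℝ}
    (h1 : u ∈ Ioc (q (l + 1)) (q l)) (h2 : u ∈ Ioc (q (m + 1)) (q m)) : l = m := by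
  rcases lt_trichotomy l m with h | h | h
  · exact absurd (h1.1.trans_le h2.2) (not_lt.2 (G.q_anti (i := l + 1) h (by omega)))
  · exact h
  · exact absurd (h2.1.trans_le h1.2) (not_lt.2 (G.q_anti (i := m + 1) h (by omega)))

lemma cellFun_eq (G : IsGrid k q a) (c : ℕ → ℝ) {l : ℕ} (hl : l ≤ k) {u : ℝ}
    (hu : u ∈ Ioc (q (l + 1)) (q l)) : cellFun k q c u = c l := by
  rw [cellFun, Finset.sum_eq_single l]
  · rw [indicator_of_mem hu]
  · intro m hm hml
    rw [Finset.mem_range] at hm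
    exact indicator_of_notMem (fun h => hml (G.level_unique (by omega) hl h hu)) _
  · intro h
    exact absurd (Finset.mem_range.2 (by omega)) h

lemma cellFun_of_notMem (G : IsGrid k q a) (c : ℕ → ℝ) {u : ℝ} (hu : u ∉ Ioc (0 : ℝ) 1) :
    cellFun k q c u = 0 := by
  refine Finset.sum_eq_zero fun l hl => indicator_of_notMem (fun h => hu ?_) _
  rw [Finset.mem_range] at hl
  exact ⟨(G.q_nonneg (by omega)).trans_lt h.1, h.2.trans (G.q_le_one (by omega))⟩

lemma integral_unifDist (G : IsGrid k q a) {f : ℝ → ℝ} (hf : Integrable f unifDist) :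
    ∫ u, f u ∂unifDist = ∑ l ∈ Finset.range (k + 1), ∫ u in Ioc (q (l + 1)) (q l), f u := by
  have hU : Ioc (0 : ℝ) 1 = ⋃ l ∈ Finset.range (k + 1), Ioc (q (l + 1)) (q l) := by
    ext u
    simp only [mem_iUnion, Finset.mem_range, exists_prop]
    constructor
    · intro hu
      obtain ⟨l, hl, h⟩ := G.exists_level hu
      exact ⟨l, by omega, h⟩
    · rintro ⟨l, hl, h⟩
      exact ⟨(G.q_nonneg (by omega)).trans_lt h.1, h.2.trans (G.q_le_one (by omega))⟩
  rw [unifDist, hU, integral_biUnion_finset _ fun _ _ => measurableSet_Ioc]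
  · intro l hl m hm hlm
    simp only [Finset.coe_range, mem_Iio] at hl hm
    exact Set.disjoint_left.2 fun u h1 h2 =>
      hlm (G.level_unique (by omega) (by omega) h1 h2)
  · intro l hl
    refine IntegrableOn.mono_set (t := Ioc 0 1) hf fun u hu => ?_
    rw [hU]
    exact mem_biUnion hl hu

lemma integral_comp_cellFun (G : IsGrid k q a) (c : ℕ → ℝ) (s : ℝ) :
    ∫ u, max (cellFun k q c u - s) 0 ∂unifDist =
      ∑ l ∈ Finset.range (k + 1), (q l - q (l + 1)) * max (c l - s) 0 := by
  have hi : Integrable (cellFun k q c) unifDist :=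
    Integrable.of_bound (measurable_cellFun k q c).aestronglyMeasurable _
      (ae_of_all _ fun u => abs_cellFun_le k q c u)
  rw [G.integral_unifDist (f := fun u => max (cellFun k q c u - s) 0)
    ((hi.sub (integrable_const s)).sup (integrable_zero _ _ _))]
  refine Finset.sum_congr rfl fun l hl => ?_
  rw [Finset.mem_range] at hl
  rw [setIntegral_congr_fun (g := fun _ => max (c l - s) 0) measurableSet_Ioc fun u hu => by
    simp only [G.cellFun_eq c (l := l) (by omega) hu]]
  rw [setIntegral_const, Real.volume_real_Ioc_of_le (G.q_lt l (by omega)).le, smul_eq_mul]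

/-! ### Interim payments of one agent -/

/-- Interim payments at values up to the top grid value are bounded by the increments of the interim
allocation along the grid. -/
lemma pay_le (G : IsGrid k q a) {x p : ℝ → ℝ} (hx : ∀ z, 0 ≤ z → 0 ≤ x z)
    (hIC : ∀ v z, 0 ≤ v → 0 ≤ z → v * x z - p z ≤ v * x v - p v)
    (hIR : ∀ v, 0 ≤ v → 0 ≤ v * x v - p v) (hmono : MonotoneOn x (Ici 0)) {m : ℕ} (hm : m ≤ k) :
    ∀ z, 0 ≤ z → z ≤ a m → p z ≤ a 0 * x (a 0) + ∑ l ∈ Finset.range m,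
      (Ioi (a l)).indicator (fun _ => a (l + 1) * (x (a (l + 1)) - x (a l))) z := by
  induction m with
  | zero =>
    intro z hz hza
    have h1 := hIR z hz
    have h2 : z * x z ≤ a 0 * x (a 0) :=
      mul_le_mul hza (hmono hz G.a_zero hza) (hx z hz) G.a_zero
    simp only [Finset.range_zero, Finset.sum_empty, add_zero]
    linarith
  | succ m ih =>
    intro z hz hza
    have ham := G.a_nonneg (l := m) (by omega)
    have ham' := G.a_nonneg hm
    have hstep := hmono ham ham' (G.a_le m (by omega))
    rw [Finset.sum_range_succ]
    rcases le_or_gt z (a m) with h | h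
    · rw [indicator_of_notMem (by simpa using h), add_zero]
      exact ih (by omega) z hz h
    · rw [indicator_of_mem (by simpa using h)]
      have h1 := ih (by omega) (a m) ham le_rfl
      have h2 : ∑ l ∈ Finset.range m,
          (Ioi (a l)).indicator (fun _ => a (l + 1) * (x (a (l + 1)) - x (a l))) (a m) ≤
          ∑ l ∈ Finset.range m,
          (Ioi (a l)).indicator (fun _ => a (l + 1) * (x (a (l + 1)) - x (a l))) z := by
        refine Finset.sum_le_sum fun l hl => ?_
        rw [Finset.mem_range] at hl
        have hl0 := G.a_nonneg (l := l) (by omega)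
        have hl1 := G.a_nonneg (l := l + 1) (by omega)
        have hlt : z ∈ Ioi (a l) := (G.a_mono hl.le (by omega)).trans_lt h
        rw [indicator_of_mem hlt]
        exact indicator_apply_le' (fun _ => le_rfl) fun _ =>
          mul_nonneg hl1 (sub_nonneg.2 (hmono hl0 hl1 (G.a_le l (by omega))))
      -- Type `z` does not gain by reporting `a m`, so `p z - p (a m) ≤ z * (x z - x (a m))`, and
      -- monotonicity replaces `z` by `a (m+1)`.
      have h3 := hIC z (a m) hz ham
      have h4 : z * (x z - x (a m)) ≤ a (m + 1) * (x (a (m + 1)) - x (a m)) :=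
        mul_le_mul hza (sub_le_sub_right (hmono hz ham' hza) _)
          (sub_nonneg.2 (hmono ham hz h.le)) ham'
      linarith

/-- The expected interim payment at non-tail values is, up to the grid ratio, at most the expected
virtual value of the allocation in quantile space. -/
lemma integral_pay_le (G : IsGrid k q a) (D : Measure ℝ) [IsProbabilityMeasure D]
    (hD : D (Iio 0) = 0) (ha : ∀ l ≤ k, a l = quantileQuery D (q l)) {δ : ℝ} (hδ : 0 ≤ δ)
    (hq : ∀ l < k, q l ≤ (1 + δ) * q (l + 1)) {x p : ℝ → ℝ} (hx : ∀ z, 0 ≤ z → 0 ≤ x z)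
    (hIC : ∀ v z, 0 ≤ v → 0 ≤ z → v * x z - p z ≤ v * x v - p v)
    (hIR : ∀ v, 0 ≤ v → 0 ≤ v * x v - p v) (hp : Integrable p D) (hxi : Integrable x D) :
    ∫ z, {z | q k < quantile D z}.indicator p z ∂D ≤
      (1 + δ) * ∫ u, max (cellFun k q (cellSlope k q a) u) 0 * x (quantileQuery D u) ∂unifDist := by
  -- Adding the two incentive constraints gives `(z - v) * (x z - x v) ≥ 0`.
  have hmono : MonotoneOn x (Ici 0) := fun v hv z hz hvz => by
    rcases hvz.eq_or_lt with h | h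
    · rw [h]
    · have h1 := hIC v z hv hz
      have h2 := hIC z v hz hv
      by_contra! hlt
      nlinarith
  have hqk : q k ∈ Ioc (0 : ℝ) 1 := ⟨G.q_pos le_rfl, G.q_le_one (by omega)⟩
  have hΔ : ∀ l < k, 0 ≤ a (l + 1) * (x (a (l + 1)) - x (a l)) := fun l hl =>
    mul_nonneg (G.a_nonneg (l := l + 1) hl) (sub_nonneg.2
      (hmono (G.a_nonneg hl.le) (G.a_nonneg (l := l + 1) hl) (G.a_le l hl)))
  have h0 : 0 ≤ a 0 * x (a 0) := mul_nonneg G.a_zero (hx _ G.a_zero)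
  have hae : ∀ᵐ z ∂D, 0 ≤ z := by
    rw [ae_iff]
    simpa [Iio_def] using hD
  have hmeas : MeasurableSet {z | q k < quantile D z} :=
    measurableSet_lt measurable_const (quantile_antitone D).measurable
  have hint : ∀ l, Integrable (fun z => (Ioi (a l)).indicator
      (fun _ => a (l + 1) * (x (a (l + 1)) - x (a l))) z) D := fun l =>
    (integrable_const _).indicator measurableSet_Ioi
  have hA : ∫ z, {z | q k < quantile D z}.indicator p z ∂D ≤
      a 0 * x (a 0) + ∑ l ∈ Finset.range k,
        D.real (Ioi (a l)) * (a (l + 1) * (x (a (l + 1)) - x (a l))) := by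
    have e : a 0 * x (a 0) + ∑ l ∈ Finset.range k,
        D.real (Ioi (a l)) * (a (l + 1) * (x (a (l + 1)) - x (a l))) =
        ∫ z, (a 0 * x (a 0) + ∑ l ∈ Finset.range k, (Ioi (a l)).indicator
          (fun _ => a (l + 1) * (x (a (l + 1)) - x (a l))) z) ∂D := by
      rw [integral_add (integrable_const _) (integrable_finsetSum _ fun l _ => hint l),
        integral_finsetSum _ fun l _ => hint l]
      simp only [integral_const, probReal_univ, one_mul, integral_indicator measurableSet_Ioi,
        measureReal_restrict_apply_univ, smul_eq_mul]
    rw [e]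
    refine integral_mono_ae (hp.indicator hmeas)
      ((integrable_const _).add (integrable_finsetSum _ fun l _ => hint l)) ?_
    filter_upwards [hae] with z hz
    by_cases hzt : z ∈ {z | q k < quantile D z}
    · rw [indicator_of_mem hzt]
      refine G.pay_le hx hIC hIR hmono le_rfl z hz ?_
      rw [ha k le_rfl, le_quantileQuery_iff D hD hqk]
      exact le_of_lt hzt
    · rw [indicator_of_notMem hzt]
      exact add_nonneg h0 (Finset.sum_nonneg fun l hl => indicator_nonneg
        (fun _ _ => hΔ l (Finset.mem_range.1 hl)) _)
  have hB : a 0 * x (a 0) + ∑ l ∈ Finset.range k,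
      D.real (Ioi (a l)) * (a (l + 1) * (x (a (l + 1)) - x (a l))) ≤
      (1 + δ) * (q 0 * a 0 * x (a 0) +
        ∑ l ∈ Finset.range k, q (l + 1) * a (l + 1) * (x (a (l + 1)) - x (a l))) := by
    rw [mul_add, Finset.mul_sum, G.q_zero]
    refine add_le_add (by nlinarith) (Finset.sum_le_sum fun l hl => ?_)
    rw [Finset.mem_range] at hl
    have h1 : D.real (Ioi (a l)) ≤ (1 + δ) * q (l + 1) := by
      rw [ha l hl.le]
      exact (measure_Ioi_quantileQuery_le D hD
        ⟨G.q_pos hl.le, G.q_le_one (by omega)⟩).trans (hq l hl)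
    calc _ ≤ (1 + δ) * q (l + 1) * (a (l + 1) * (x (a (l + 1)) - x (a l))) :=
          mul_le_mul_of_nonneg_right h1 (hΔ l hl)
      _ = _ := by ring
  refine (hA.trans hB).trans (mul_le_mul_of_nonneg_left ?_ (by linarith))
  refine (G.sum_abel (x := fun l => x (a l)) (hx _ G.a_zero) fun l hl =>
    hmono (G.a_nonneg hl.le) (G.a_nonneg (l := l + 1) hl) (G.a_le l hl)).trans ?_
  have hV := measurePreserving_quantileQuery D hD
  have hxV : Integrable (fun u => x (quantileQuery D u)) unifDist :=
    hV.integrable_comp_of_integrable hxi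
  have hψ : Integrable (fun u => max (cellFun k q (cellSlope k q a) u) 0 *
      x (quantileQuery D u)) unifDist := by
    refine hxV.bdd_mul (c := ∑ l ∈ Finset.range (k + 1), |cellSlope k q a l|)
      ((measurable_cellFun k q _).max measurable_const).aestronglyMeasurable
      (ae_of_all _ fun u => ?_)
    rw [Real.norm_of_nonneg (le_max_right _ _)]
    exact max_le ((le_abs_self _).trans (abs_cellFun_le k q _ u))
      ((abs_nonneg _).trans (abs_cellFun_le k q _ u))
  rw [G.integral_unifDist hψ]
  -- On the `l`-th cell the true value is at least `a l`, so the allocation is at least `x (a l)`;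
  -- truncating the slope at 0 keeps the product bound valid for negative slopes.
  refine Finset.sum_le_sum fun l hl => ?_
  rw [Finset.mem_range, Nat.lt_succ_iff] at hl
  have hsub : Ioc (q (l + 1)) (q l) ⊆ Ioc 0 1 := fun u hu =>
    ⟨(G.q_nonneg (by omega)).trans_lt hu.1, hu.2.trans (G.q_le_one (by omega))⟩
  have hc : ∫ _ in Ioc (q (l + 1)) (q l), cellSlope k q a l * x (a l) =
      (q l - q (l + 1)) * cellSlope k q a l * x (a l) := by
    rw [setIntegral_const, Real.volume_real_Ioc_of_le (G.q_lt l hl).le, smul_eq_mul, mul_assoc]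
  rw [← hc]
  refine setIntegral_mono_on (integrableOn_const (by simp))
    (IntegrableOn.mono_set (t := Ioc 0 1) hψ hsub) measurableSet_Ioc fun u hu => ?_
  rw [G.cellFun_eq _ hl hu]
  have hal := G.a_nonneg hl
  have hau : a l ≤ quantileQuery D u := by
    rw [ha l hl]
    exact quantileQuery_antitoneOn D hD (hsub hu) ⟨G.q_pos hl, G.q_le_one (by omega)⟩ hu.2
  exact mul_le_mul (le_max_left _ _) (hmono hal (hal.trans hau) hau) (hx _ hal) (le_max_right _ _)

end IsGrid

/-! ### The quantile vector -/

section quantileVector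

variable {ε₁ δ : ℝ}

lemma one_le_levels (hε₁ : ε₁ ∈ Ioo (0 : ℝ) 1) (hδ : 0 < δ) : 1 ≤ levels ε₁ δ := by
  rw [levels, Nat.one_le_ceil_iff]
  exact Real.logb_pos (by linarith) ((one_lt_div hε₁.1).2 hε₁.2)

lemma one_le_mul_pow_levels (hε₁ : ε₁ ∈ Ioo (0 : ℝ) 1) (hδ : 0 < δ) :
    1 ≤ ε₁ * (1 + δ) ^ levels ε₁ δ := by
  have h := Nat.le_ceil (Real.logb (1 + δ) (1 / ε₁))
  rw [Real.logb_le_iff_le_rpow (by linarith) (one_div_pos.2 hε₁.1), Real.rpow_natCast,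
    div_le_iff₀ hε₁.1, mul_comm] at h
  exact h

/-- Minimality of the ceiling gives `q 1 < q 0`, while the previous lemma keeps the first ratio `q 0
/ q 1` at most `1 + δ`. -/
lemma mul_pow_levels_lt_one (hε₁ : ε₁ ∈ Ioo (0 : ℝ) 1) (hδ : 0 < δ) :
    ε₁ * (1 + δ) ^ (levels ε₁ δ - 1) < 1 := by
  have h1 := one_le_levels hε₁ hδ
  have h : ((levels ε₁ δ - 1 : ℕ) : ℝ) < Real.logb (1 + δ) (1 / ε₁) := by
    rw [← Nat.lt_ceil]
    exact Nat.sub_lt h1 one_pos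
  rw [Real.lt_logb_iff_rpow_lt (by linarith) (one_div_pos.2 hε₁.1), Real.rpow_natCast,
    lt_div_iff₀ hε₁.1, mul_comm] at h
  exact h

lemma quantileVector_of_mem {l : ℕ} (h1 : 1 ≤ l) (h2 : l ≤ levels ε₁ δ) :
    quantileVector ε₁ δ l = ε₁ * (1 + δ) ^ (levels ε₁ δ - l) := by
  rw [quantileVector, if_neg (by omega), if_pos h2]

lemma quantileVector_succ_lt (hε₁ : ε₁ ∈ Ioo (0 : ℝ) 1) (hδ : 0 < δ) {l : ℕ}
    (hl : l ≤ levels ε₁ δ) : quantileVector ε₁ δ (l + 1) < quantileVector ε₁ δ l := by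
  have hpos : ∀ m : ℕ, 0 < ε₁ * (1 + δ) ^ m := fun m =>
    mul_pos hε₁.1 (pow_pos (by linarith) m)
  rcases Nat.eq_zero_or_pos l with rfl | h0
  · rw [quantileVector_of_mem le_rfl (one_le_levels hε₁ hδ)]
    simpa [quantileVector] using mul_pow_levels_lt_one hε₁ hδ
  · rw [quantileVector_of_mem h0 hl]
    rcases hl.lt_or_eq with h | h
    · rw [quantileVector_of_mem (by omega) h]
      exact mul_lt_mul_of_pos_left (pow_lt_pow_right₀ (by linarith) (by omega)) hε₁.1
    · rw [quantileVector, if_neg (by omega), if_neg (by omega)]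
      exact hpos _

lemma quantileVector_le (hε₁ : ε₁ ∈ Ioo (0 : ℝ) 1) (hδ : 0 < δ) {l : ℕ}
    (hl : l < levels ε₁ δ) :
    quantileVector ε₁ δ l ≤ (1 + δ) * quantileVector ε₁ δ (l + 1) := by
  rw [quantileVector_of_mem (by omega) hl, mul_left_comm, ← pow_succ']
  rcases Nat.eq_zero_or_pos l with rfl | h0
  · rw [show levels ε₁ δ - (0 + 1) + 1 = levels ε₁ δ by omega]
    simpa [quantileVector] using one_le_mul_pow_levels hε₁ hδ
  · rw [quantileVector_of_mem h0 hl.le, show levels ε₁ δ - (l + 1) + 1 = levels ε₁ δ - l by omega]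

lemma quantileVector_levels (hε₁ : ε₁ ∈ Ioo (0 : ℝ) 1) (hδ : 0 < δ) :
    quantileVector ε₁ δ (levels ε₁ δ) = ε₁ := by
  rw [quantileVector_of_mem (one_le_levels hε₁ hδ) le_rfl]
  simp

lemma quantileVector_mem (hε₁ : ε₁ ∈ Ioo (0 : ℝ) 1) (hδ : 0 < δ) {l : ℕ}
    (hl : l ≤ levels ε₁ δ) : quantileVector ε₁ δ l ∈ Ioc (0 : ℝ) 1 := by
  rcases Nat.eq_zero_or_pos l with rfl | h0
  · simp [quantileVector]
  · rw [quantileVector_of_mem h0 hl]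
    refine ⟨mul_pos hε₁.1 (pow_pos (by linarith) _), ?_⟩
    refine le_trans ?_ (mul_pow_levels_lt_one hε₁ hδ).le
    exact mul_le_mul_of_nonneg_left (pow_le_pow_right₀ (by linarith) (by omega)) hε₁.1.le

lemma isGrid_quantileVector (hε₁ : ε₁ ∈ Ioo (0 : ℝ) 1) (hδ : 0 < δ) (D : Measure ℝ)
    [IsProbabilityMeasure D] (hD : D (Iio 0) = 0) :
    IsGrid (levels ε₁ δ) (quantileVector ε₁ δ)
      fun l => quantileQuery D (quantileVector ε₁ δ l) where
  q_zero := by simp [quantileVector]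
  q_last := by simp [quantileVector]
  q_lt l hl := quantileVector_succ_lt hε₁ hδ hl
  a_zero := quantileQuery_nonneg D hD _
  a_le l hl := quantileQuery_antitoneOn D hD (quantileVector_mem hε₁ hδ hl)
    (quantileVector_mem hε₁ hδ hl.le) (quantileVector_succ_lt hε₁ hδ hl.le).le

end quantileVector

/-! ### Revenue guarantee of learned priors -/

section guarantee

variable {k : ℕ} {q : ℕ → ℝ} {D : Fin n → Measure ℝ} [∀ i, IsProbabilityMeasure (D i)]

/-- The grid distribution built from the oracle's answers. -/
def answerDist (k : ℕ) (q : ℕ → ℝ) (D : Measure ℝ) : Measure ℝ :=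
  gridDist k q fun l => quantileQuery D (q l)

/-- The learned virtual value as a function of the quantile. -/
def learnedSlope (k : ℕ) (q : ℕ → ℝ) (D : Measure ℝ) : ℝ → ℝ :=
  cellFun k q (IsGrid.cellSlope k q fun l => quantileQuery D (q l))

lemma integral_learnedSlope_le_rev (hD : ∀ i, D i (Iio 0) = 0)
    (G : ∀ i, IsGrid k q fun l => quantileQuery (D i) (q l))
    {x : (Fin n → ℝ) → Fin n → ℝ} (hx : ∀ i, Measurable fun u => x u i)
    (hx0 : ∀ u i, 0 ≤ x u i) (hx1 : ∀ u, ∑ i, x u i ≤ 1) :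
    ∫ u, ∑ i, max (learnedSlope k q (D i) (u i)) 0 * x u i ∂(Measure.pi fun _ => unifDist) ≤
      (myerson fun i => answerDist k q (D i)).rev D := by
  have hmem : ∀ (i : Fin n) {l : ℕ}, l ≤ k → q l ∈ Ioc (0 : ℝ) 1 := fun i l hl =>
    ⟨(G i).q_pos hl, (G i).q_le_one (by omega)⟩
  refine le_myerson_rev (ψ := fun i => learnedSlope k q (D i)) D hD
    (fun i => (G i).monotone_ironedVirtualValue)
    (fun i => (G i).finite_range_ironedVirtualValue)
    (fun i z => (G i).ironedVirtualValue_lt_top z) (fun i => measurable_cellFun _ _ _)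
    (C := ∑ i, ∑ l ∈ Finset.range (k + 1),
      |IsGrid.cellSlope k q (fun l => quantileQuery (D i) (q l)) l|)
    (fun i u => (abs_cellFun_le _ _ _ u).trans ?_) (fun i u hu => ?_) (fun i s W hW => ?_) hx hx0 hx1
  · exact Finset.single_le_sum (f := fun i => ∑ l ∈ Finset.range (k + 1),
      |IsGrid.cellSlope k q (fun l => quantileQuery (D i) (q l)) l|)
      (fun i _ => Finset.sum_nonneg fun l _ => abs_nonneg _) (Finset.mem_univ i)
  · by_cases hu1 : u ∈ Ioc (0 : ℝ) 1
    · obtain ⟨l, hl, hul⟩ := (G i).exists_level hu1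
      simp only [learnedSlope, (G i).cellFun_eq _ hl hul]
      exact (G i).cellSlope_le_ironedVirtualValue hl
        (quantileQuery_antitoneOn (D i) (hD i) hu1 (hmem i hl) hul.2)
    -- Outside `(0, 1]` the learned slope is 0, so its assumed positivity fails.
    · simp only [learnedSlope, (G i).cellFun_of_notMem _ hu1] at hu
      exact absurd hu (lt_irrefl _)
  · simp only [learnedSlope, (G i).integral_comp_cellFun]
    refine (G i).pricing (D i) (fun l hl => ?_) s hW
    exact (le_quantileQuery_iff (D i) (hD i) (hmem i hl)).1 le_rfl

/-- Excluding only a player's own tail, rather than everyone's, can only increase the total because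
payments are nonnegative. The bound then splits over players and reduces to interim payments. -/
lemma integral_nontail_revAt_le (hD : ∀ i, D i (Iio 0) = 0)
    (G : ∀ i, IsGrid k q fun l => quantileQuery (D i) (q l)) {δ : ℝ} (hδ : 0 ≤ δ)
    (hq : ∀ l < k, q l ≤ (1 + δ) * q (l + 1)) {M : Mechanism n} (hM : M.BIC D)
    (hpay : ∀ v : Fin n → ℝ, (∀ j, 0 ≤ v j) → ∀ i, 0 ≤ M.pay v i) :
    ∫ v, {v : Fin n → ℝ | ∃ i, quantile (D i) (v i) ≤ q k}ᶜ.indicator M.revAt v ∂(Measure.pi D) ≤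
      (1 + δ) * ∫ u, ∑ i, max (learnedSlope k q (D i) (u i)) 0 * M.alloc (valuesAt D u) i
        ∂(Measure.pi fun _ => unifDist) := by
  set μ : Measure (Fin n → ℝ) := Measure.pi fun _ => unifDist with hμ
  have hV := measurePreserving_valuesAt D hD
  have hqm : ∀ i, Measurable (quantile (D i)) := fun i => (quantile_antitone (D i)).measurable
  have hx1 : ∀ b i, M.alloc b i ≤ 1 := fun b i =>
    (Finset.single_le_sum (fun i _ => (hM.feasible b).1 i) (Finset.mem_univ i)).trans
      (hM.feasible b).2
  set P : Fin n → (Fin n → ℝ) → ℝ := fun i v =>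
    {z | q k < quantile (D i) z}.indicator (fun _ => M.pay v i) (v i) with hP
  have hmeas : ∀ i, MeasurableSet {z | q k < quantile (D i) z} := fun i =>
    measurableSet_lt measurable_const (hqm i)
  have hPint : ∀ i, Integrable (P i) (Measure.pi D) := fun i =>
    Integrable.indicator (s := (fun v : Fin n → ℝ => v i) ⁻¹' {z | q k < quantile (D i) z})
      (hM.integrable_pay i) (measurable_pi_apply i (hmeas i))
  have hae : ∀ᵐ v ∂(Measure.pi D), ∀ i, 0 ≤ v i := by
    rw [ae_all_iff]
    intro i
    refine (measurePreserving_eval D i).quasiMeasurePreserving.ae (p := fun z => 0 ≤ z) ?_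
    rw [ae_iff]
    simpa [Iio_def] using hD i
  have hset : MeasurableSet {v : Fin n → ℝ | ∃ i, quantile (D i) (v i) ≤ q k} := by
    rw [ofPred_exists]
    exact MeasurableSet.iUnion fun i =>
      measurableSet_le ((hqm i).comp (measurable_pi_apply i)) measurable_const
  have hrint : Integrable M.revAt (Measure.pi D) :=
    integrable_finsetSum _ fun i _ => hM.integrable_pay i
  have h1 : ∫ v, {v : Fin n → ℝ | ∃ i, quantile (D i) (v i) ≤ q k}ᶜ.indicator M.revAt v
      ∂(Measure.pi D) ≤ ∑ i, ∫ v, P i v ∂(Measure.pi D) := by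
    rw [← integral_finsetSum _ fun i _ => hPint i]
    refine integral_mono_ae (hrint.indicator hset.compl)
      (integrable_finsetSum _ fun i _ => hPint i) ?_
    filter_upwards [hae] with v hv
    refine indicator_apply_le' (fun h => ?_) fun _ => ?_
    · simp only [mem_compl_iff, mem_ofPred_eq, not_exists, not_le] at h
      refine Finset.sum_le_sum fun i _ => ?_
      simp only [hP]
      rw [indicator_of_mem (show v i ∈ {z | q k < quantile (D i) z} from h i)]
    · exact Finset.sum_nonneg fun i _ => indicator_nonneg (fun _ _ => hpay v hv i) _
  have hψint : ∀ i, Integrable (fun u : Fin n → ℝ =>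
      max (learnedSlope k q (D i) (u i)) 0 * M.alloc (valuesAt D u) i) μ := fun i => by
    have hm : Measurable fun u : Fin n → ℝ => learnedSlope k q (D i) (u i) :=
      (measurable_cellFun _ _ _).comp (measurable_pi_apply i)
    have hb : Integrable (fun u : Fin n → ℝ => learnedSlope k q (D i) (u i)) μ :=
      Integrable.of_bound hm.aestronglyMeasurable _ (ae_of_all _ fun u => abs_cellFun_le _ _ _ _)
    refine Integrable.mul_bdd (c := 1) (hb.sup (integrable_zero _ _ _))
      ((hM.measurable_alloc i).comp hV.measurable).aestronglyMeasurable (ae_of_all _ fun u => ?_)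
    rw [Real.norm_of_nonneg ((hM.feasible _).1 i)]
    exact hx1 _ i
  rw [integral_finsetSum _ fun i _ => hψint i, Finset.mul_sum]
  refine h1.trans (Finset.sum_le_sum fun i _ => ?_)
  have haint : Integrable (fun b => M.alloc b i) (Measure.pi D) :=
    Integrable.of_bound (C := 1) (hM.measurable_alloc i).aestronglyMeasurable
      (ae_of_all _ fun b => by
        rw [Real.norm_of_nonneg ((hM.feasible _).1 i)]
        exact hx1 _ i)
  have hL : ∫ v, P i v ∂(Measure.pi D) =
      ∫ z, {z | q k < quantile (D i) z}.indicator (M.interimPay D i) z ∂(D i) := by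
    rw [integral_eq_integral_integral_update_symm i (hPint i)]
    refine integral_congr_ae (ae_of_all _ fun z => ?_)
    simp only [hP, Function.update_self]
    by_cases hz : z ∈ {z | q k < quantile (D i) z}
    · simp only [indicator_of_mem hz, Mechanism.interimPay]
    · simp only [indicator_of_notMem hz, integral_zero]
  have hR : ∫ u, max (learnedSlope k q (D i) (u i)) 0 * M.alloc (valuesAt D u) i ∂μ =
      ∫ t, max (learnedSlope k q (D i) t) 0 *
        M.interimAlloc D i (quantileQuery (D i) t) ∂unifDist := by
    rw [integral_eq_integral_integral_update_symm i (hψint i)]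
    refine integral_congr_ae (ae_of_all _ fun t => ?_)
    simp only [Function.update_self, valuesAt_update, integral_const_mul]
    rw [Mechanism.interimAlloc, ← hV.map_eq, integral_map hV.measurable.aemeasurable]
    refine ((hM.measurable_alloc i).comp ?_).aestronglyMeasurable
    exact measurable_update_left
  rw [hL, hR]
  refine (G i).integral_pay_le (D i) (hD i) (fun _ _ => rfl) hδ hq (fun z _ => ?_)
    (hM.incentive i) (hM.rational i) ?_ ?_
  · exact integral_nonneg fun b => (hM.feasible _).1 i
  · exact (integrable_update i (hM.integrable_pay i)).integral_prod_right
  · exact (integrable_update i haint).integral_prod_right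

end guarantee

end

end SingleItem

/-! ### Assembling the approximation guarantee -/

open SingleItem

theorem mainTheorem5 {n : ℕ} (D : Fin n → MeasureTheory.Measure ℝ)
    [∀ i, MeasureTheory.IsProbabilityMeasure (D i)]
    (hD : ∀ i, D i (Set.Iio 0) = 0)
    (h : ℝ → ℝ) (hST : SingleItem.SmallTail2 D h) (ε : ℝ) (hε : 0 < ε) :
    -- truthful: a feasible auction that is DSIC and individually rational
    ((SingleItem.efficientQuantileMyerson n h ε).onPrior D).Feasible ∧
    ((SingleItem.efficientQuantileMyerson n h ε).onPrior D).DSIC ∧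
    ((SingleItem.efficientQuantileMyerson n h ε).onPrior D).ExPostIR ∧
    -- the queries are quantiles in `(0, 1]`, and their number
    (∀ i l, (SingleItem.efficientQuantileMyerson n h ε).query i l ∈ Set.Ioc (0 : ℝ) 1) ∧
    (SingleItem.efficientQuantileMyerson n h ε).queryComplexity =
      n * (⌈-Real.logb (1 + ε / 3) (h (2 * ε / (3 * (1 + ε))))⌉₊ + 1) ∧
    (1 ≤ -Real.logb (1 + ε / 3) (h (2 * ε / (3 * (1 + ε)))) →
      ((SingleItem.efficientQuantileMyerson n h ε).queryComplexity : ℝ) ≤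
        3 * (-(n : ℝ) * Real.logb (1 + ε / 3) (h (2 * ε / (3 * (1 + ε)))))) ∧
    -- the revenue
    MeasureTheory.Integrable ((SingleItem.efficientQuantileMyerson n h ε).onPrior D).revAt
      (MeasureTheory.Measure.pi D) ∧
    SingleItem.OPT D / (1 + ε) ≤
      ((SingleItem.efficientQuantileMyerson n h ε).onPrior D).rev D := by
  obtain ⟨hh, M, ⟨hM, hopt⟩, hpay, htail⟩ := hST
  have hτ : tailParam ε ∈ Set.Ioo (0 : ℝ) 1 := by
    refine ⟨by unfold tailParam; positivity, ?_⟩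
    rw [tailParam, div_lt_one (by positivity)]
    linarith
  have hε₁ := hh _ hτ
  have hδ : 0 < ε / 3 := by positivity
  set ε₁ := h (tailParam ε) with hε₁def
  have hε₁' : h (2 * ε / (3 * (1 + ε))) = ε₁ := rfl
  set k := levels ε₁ (ε / 3) with hk
  set q := quantileVector ε₁ (ε / 3) with hq
  have G : ∀ i, IsGrid k q fun l => quantileQuery (D i) (q l) := fun i =>
    isGrid_quantileVector hε₁ hδ (D i) (hD i)
  have hmech : (efficientQuantileMyerson n h ε).onPrior D =
      myerson fun i => answerDist k q (D i) := rfl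
  have hφ : ∀ i, Monotone (ironedVirtualValue (answerDist k q (D i))) := fun i =>
    (G i).monotone_ironedVirtualValue
  have hcount : (efficientQuantileMyerson n h ε).queryComplexity =
      n * (⌈-Real.logb (1 + ε / 3) ε₁⌉₊ + 1) := by
    have : levels ε₁ (ε / 3) = ⌈-Real.logb (1 + ε / 3) ε₁⌉₊ := by
      rw [levels, one_div, Real.logb_inv]
    rw [← this]
    simp [QueryMechanism.queryComplexity, efficientQuantileMyerson, ← hε₁def]
  rw [hε₁', hmech]
  refine ⟨myerson_feasible _, myerson_dsic hφ, myerson_exPostIR _, fun i l => ?_, hcount,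
    fun h1 => ?_, integrable_myerson_revAt D hφ fun i => (G i).finite_range_ironedVirtualValue, ?_⟩
  · exact quantileVector_mem hε₁ hδ (Nat.lt_succ_iff.1 l.2)
  · rw [hcount]
    push_cast
    -- For `L ≥ 1` one has `⌈L⌉ + 1 ≤ L + 2 ≤ 3 L`.
    have h2 := (Nat.ceil_lt_add_one (a := -Real.logb (1 + ε / 3) ε₁) (by linarith)).le
    nlinarith [Nat.cast_nonneg (α := ℝ) n]
  · have hOPT : OPT D = M.rev D :=
      IsGreatest.csSup_eq ⟨⟨M, hM, rfl⟩, by rintro r ⟨M', hM', rfl⟩; exact hopt M' hM'⟩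
    have hV := measurePreserving_valuesAt D hD
    -- The optimal mechanism's own allocation, read in quantile space, is the feasible `x` shared by
    -- both bounds.
    have hlow := integral_learnedSlope_le_rev hD G (x := fun u => M.alloc (valuesAt D u))
      (fun i => (hM.measurable_alloc i).comp hV.measurable)
      (fun u i => (hM.feasible _).1 i) fun u => (hM.feasible _).2
    have hup := integral_nontail_revAt_le hD G hδ.le
      (fun l hl => quantileVector_le hε₁ hδ hl) hM hpay
    have ht := htail _ hτ
    rw [hq, hk, quantileVector_levels hε₁ hδ] at hup
    rw [← hε₁def] at ht
    have hset : MeasurableSet {v : Fin n → ℝ | ∃ i, quantile (D i) (v i) ≤ ε₁} := by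
      rw [Set.ofPred_exists]
      exact MeasurableSet.iUnion fun i => measurableSet_le
        ((quantile_antitone (D i)).measurable.comp (measurable_pi_apply i)) measurable_const
    have hrint : Integrable M.revAt (Measure.pi D) :=
      integrable_finsetSum _ fun i _ => hM.integrable_pay i
    have hsplit : M.rev D =
        (∫ v, Set.indicator {v : Fin n → ℝ | ∃ i, quantile (D i) (v i) ≤ ε₁} M.revAt v
          ∂(Measure.pi D)) +
        ∫ v, {v : Fin n → ℝ | ∃ i, quantile (D i) (v i) ≤ ε₁}ᶜ.indicator M.revAt v
          ∂(Measure.pi D) := by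
      rw [integral_indicator hset, integral_indicator hset.compl,
        integral_add_compl hset hrint, Mechanism.rev]
    have hfin : (1 - tailParam ε) * OPT D ≤
        (1 + ε / 3) * (myerson fun i => answerDist k q (D i)).rev D := by
      have := mul_le_mul_of_nonneg_left hlow (by linarith : (0 : ℝ) ≤ 1 + ε / 3)
      linarith
    -- This identity fixes the parameters: the factor `1 + ε/3` lost by rounding quantiles cancels,
    -- leaving `1/(1+ε)`.
    have he : 1 - tailParam ε = (1 + ε / 3) / (1 + ε) := by
      rw [tailParam]
      field_simp
      ring
    rw [he, div_mul_eq_mul_div, mul_div_assoc] at hfin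
    exact le_of_mul_le_mul_left hfin (by linarith)
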